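/- Let $\mathbb H^3$ be hyperbolic $3$-space in the upper half-space model, with boundary $\hat{\mathbb C}=\mathbb C\cup\{\infty\}$ and base point $o=(0,1)$. Let $d\ge 1$, $G=\prod_{i=1}^d\mathrm{PSL}_2(\mathbb C)$, let $\Gamma<\mathrm{PSL}_2(\mathbb C)$ be a convex cocompact discrete subgroup (i.e. $\Gamma\backslash\mathrm{hull}(\Lambda_\Gamma)$ is compact, where $\Lambda_\Gamma\subset\hat{\mathbb C}$ is the limit set of $\Gamma$ and $\mathrm{hull}(\Lambda_\Gamma)\subset\mathbb H^3$ its convex hull), and let $\rho=(\rho_1=\mathrm{id},\rho_2,\dots,\rho_d)$ be a $d$-tuple of faithful representations $\rho_i:\Gamma\to\mathrm{PSL}_2(\mathbb C)$ whose images are convex cocompact discrete subgroups. Let $\Gamma_\rho=\{(\rho_1(g),\dots,\rho_d(g)):g\in\Gamma\}<G$, and assume that $\Gamma_\rho$ is Zariski dense in $G$ (as a real algebraic group). Let $f_i:\Lambda_\Gamma\to\Lambda_{\rho_i(\Gamma)}$ be the $\rho_i$-boundary map, i.e. the unique homeomorphism with $f_i(g\xi)=\rho_i(g)f_i(\xi)$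 for all $g\in\Gamma$, $\xi\in\Lambda_\Gamma$. Circles are circles in $\hat{\mathbb C}$ (lines together with $\infty$ included), and a torus is a $d$-tuple $T=(C_1,\dots,C_d)$ of circles. A set of circles (resp. of tori) is locally finite if no infinite sequence of distinct members converges to a circle (resp. to a torus). A torus $T=(C_1,\dots,C_d)$ is $\Gamma_\rho$-admissible if for each $1\le i\le d$ the circle packing $\rho_i(\Gamma)C_i$ is locally finite and $f_i(C_1\cap\Lambda_\Gamma)=C_i\cap\Lambda_{\rho_i(\Gamma)}$. A set $\mathcal P$ of tori is a $\Gamma_\rho$-admissible torus packing if it consists of finitely many $\Gamma_\rho$-orbits of $\Gamma_\rho$-admissible tori and is locally finite. Let $T_0=(C_0,\dots,C_0)$ with $C_0=\{|z|=1\}$, let $H=\mathrm{Stab}_G(T_0)$, and let $$A^+=\Big\{\Big(\begin{pmatrix}e^{t_1/2}&0\\0&e^{-t_1/2}\end{pmatrix},\dots,\begin{pmatrix}e^{t_d/2}&0\\0&e^{-t_d/2}\end{pmatrix}\Big): t_1,\dots,t_d\ge 0\Big\}\subset G.$$ Call a subset of a topological space bounded if it is contained in a compact subset. **Proposition.** If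 $\mathcal P=\Gamma_\rho T_0$ is $\Gamma_\rho$-admissible, then for every bounded subset $\mathcal O\subset\Gamma_\rho\backslash G$ the set $$\{[h]\in(\Gamma_\rho\cap H)\backslash H:\ [h]A^+\cap\mathcal O\ne\emptyset\}$$ is a bounded subset of $(\Gamma_\rho\cap H)\backslash H$; here $[h]A^+$ denotes the image of $hA^+$ in $\Gamma_\rho\backslash G$. -/

import Mathlib

open Set Filter Topology
open scoped MatrixGroups Pointwise ComplexConjugate

noncomputable section

namespace TorusPacking

/-! ### Hyperbolic 3-space, the Riemann sphere and the action of `PSL₂(ℂ)` -/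

/-- The Riemann sphere `ℂ ∪ {∞}`. -/
abbrev Sphere : Type := OnePoint ℂ

/-- The group `PSL₂(ℂ)`, with the quotient topology from `SL₂(ℂ)`. -/
abbrev PSL2C : Type := PSL(2, ℂ)

/-- The upper half-space model `{(z, r) : z ∈ ℂ, r > 0}` of hyperbolic 3-space. -/
@[ext] structure HypSpace : Type where
  z : ℂ
  r : ℝ
  pos : 0 < r

namespace HypSpace

/-- The inclusion of the upper half-space into `ℂ × ℝ`. -/
def toProd (x : HypSpace) : ℂ × ℝ := (x.z, x.r)

instance : TopologicalSpace HypSpace := TopologicalSpace.induced toProd inferInstance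

/-- The hyperbolic distance (curvature `-1`) in the upper half-space model:
`sinh (d / 2) = |x - y| / (2 √(r(x) r(y)))` with `|x - y|` the Euclidean distance. -/
def hdist (x y : HypSpace) : ℝ :=
  2 * Real.arsinh (√(‖x.z - y.z‖ ^ 2 + (x.r - y.r) ^ 2) / (2 * √(x.r * y.r)))

/-- The base point `o = (0, 1)`. -/
def o : HypSpace := ⟨0, 1, one_pos⟩

/-- The denominator `|cz + d|² + |c|² r²` of the Poincaré extension of a Möbius map. -/
def denom (g : SL(2, ℂ)) (x : HypSpace) : ℝ :=
  Complex.normSq (g 1 0 * x.z + g 1 1) + Complex.normSq (g 1 0) * x.r ^ 2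

/-- The numerator of the `ℂ`-coordinate of the Poincaré extension of a Möbius map. -/
def num (g : SL(2, ℂ)) (x : HypSpace) : ℂ :=
  (g 0 0 * x.z + g 0 1) * conj (g 1 0 * x.z + g 1 1) + g 0 0 * conj (g 1 0) * (x.r : ℂ) ^ 2

theorem det_eq (g : SL(2, ℂ)) : g 0 0 * g 1 1 - g 0 1 * g 1 0 = 1 := by
  have := g.det_coe
  rwa [Matrix.det_fin_two] at this

theorem denom_pos (g : SL(2, ℂ)) (x : HypSpace) : 0 < denom g x := by
  unfold denom
  by_cases hc : g 1 0 = 0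
  · have hd : g 1 1 ≠ 0 := by
      intro hd
      have := det_eq g
      simp [hc, hd] at this
    have := Complex.normSq_pos.2 hd
    simpa [hc] using this
  · have h1 := Complex.normSq_pos.2 hc
    have h2 := Complex.normSq_nonneg (g 1 0 * x.z + g 1 1)
    have h3 := pow_pos x.pos 2
    positivity

/-- The isometric action of `SL₂(ℂ)` on the upper half-space (Poincaré extension of Möbius
transformations). -/
instance : SMul SL(2, ℂ) HypSpace where
  smul g x := ⟨num g x / (denom g x : ℂ), x.r / denom g x, div_pos x.pos (denom_pos g x)⟩

theorem smul_z (g : SL(2, ℂ)) (x : HypSpace) : (g • x).z = num g x / (denom g x : ℂ) := rfl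

theorem smul_r (g : SL(2, ℂ)) (x : HypSpace) : (g • x).r = x.r / denom g x := rfl

theorem denom_coe (g : SL(2, ℂ)) (x : HypSpace) : (denom g x : ℂ) =
    (g 1 0 * x.z + g 1 1) * conj (g 1 0 * x.z + g 1 1) + g 1 0 * conj (g 1 0) * (x.r : ℂ) ^ 2 := by
  rw [Complex.mul_conj, Complex.mul_conj]
  simp [denom]

theorem denom_ne (g : SL(2, ℂ)) (x : HypSpace) : (denom g x : ℂ) ≠ 0 := by
  exact_mod_cast (denom_pos g x).ne'

theorem num_mul_conj (g : SL(2, ℂ)) (x : HypSpace) :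
    num g x * conj (num g x) + (x.r : ℂ) ^ 2 = (denom g x : ℂ) *
    ((g 0 0 * x.z + g 0 1) * conj (g 0 0 * x.z + g 0 1) +
      g 0 0 * conj (g 0 0) * (x.r : ℂ) ^ 2) := by
  have h1 := det_eq g
  have h2 := congrArg conj h1
  rw [denom_coe]
  simp only [num, map_sub, map_mul, map_add, map_one, map_pow, Complex.conj_conj,
    Complex.conj_ofReal] at h2 ⊢
  linear_combination (-(x.r : ℂ) ^ 2 * (conj (g 0 0) * conj (g 1 1) - conj (g 0 1) * conj (g 1 0)))
    * h1 - (x.r : ℂ) ^ 2 * h2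

theorem denom_mul (g h : SL(2, ℂ)) (x : HypSpace) :
    denom (g * h) x = denom g (h • x) * denom h x := by
  have key := num_mul_conj h x
  have hne := denom_ne h x
  suffices H : ((denom (g * h) x : ℝ) : ℂ) = denom g (h • x) * denom h x by exact_mod_cast H
  rw [denom_coe g (h • x)]
  simp only [map_add, map_mul, map_div₀, Complex.conj_ofReal, smul_z, smul_r, Complex.ofReal_div]
  field_simp
  have e : (denom h x : ℂ) * (denom (g * h) x : ℂ) =
      g 1 0 * conj (g 1 0) * (num h x * conj (num h x) + (x.r : ℂ) ^ 2)
      + (denom h x : ℂ) * (g 1 0 * conj (g 1 1) * num h x + conj (g 1 0) * g 1 1 * conj (num h x)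
      + g 1 1 * conj (g 1 1) * denom h x) := by
    rw [key]
    simp only [denom_coe, num, Matrix.SpecialLinearGroup.coe_mul, Matrix.mul_apply,
      Fin.sum_univ_two, map_mul, map_add, map_pow, Complex.conj_conj, Complex.conj_ofReal]
    ring
  linear_combination e

theorem num_mul (g h : SL(2, ℂ)) (x : HypSpace) :
    num (g * h) x = num g (h • x) * (denom h x : ℂ) := by
  have key := num_mul_conj h x
  have hne := denom_ne h x
  conv_rhs => rw [num]
  simp only [map_add, map_mul, map_div₀, Complex.conj_ofReal, smul_z, smul_r, Complex.ofReal_div]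
  field_simp
  have e : (denom h x : ℂ) * num (g * h) x =
      g 0 0 * conj (g 1 0) * (num h x * conj (num h x) + (x.r : ℂ) ^ 2)
      + (denom h x : ℂ) * (g 0 0 * conj (g 1 1) * num h x + conj (g 1 0) * g 0 1 * conj (num h x)
      + g 0 1 * conj (g 1 1) * denom h x) := by
    rw [key]
    simp only [denom_coe, num, Matrix.SpecialLinearGroup.coe_mul, Matrix.mul_apply,
      Fin.sum_univ_two, map_mul, map_add, map_pow, Complex.conj_conj, Complex.conj_ofReal]
    ring
  linear_combination e

instance : MulAction SL(2, ℂ) HypSpace where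
  one_smul x := by
    have hd : denom 1 x = 1 := by simp [denom]
    ext
    · simp [smul_z, hd, num]
    · simp [smul_r, hd]
  mul_smul g h x := by
    ext
    · rw [smul_z, smul_z, num_mul, denom_mul]
      push_cast
      exact mul_div_mul_right _ _ (denom_ne h x)
    · rw [smul_r, smul_r, smul_r, denom_mul, mul_comm, div_div]

/-- The centre `{±1}` acts trivially on the upper half-space. -/
theorem center_le : Subgroup.center SL(2, ℂ) ≤ (MulAction.toPermHom SL(2, ℂ) HypSpace).ker := by
  intro g hg
  obtain ⟨r, hr, hg⟩ := Matrix.SpecialLinearGroup.mem_center_iff.1 hg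
  have h00 : g 0 0 = r := by rw [← hg]; simp
  have h01 : g 0 1 = 0 := by rw [← hg]; simp
  have h10 : g 1 0 = 0 := by rw [← hg]; simp
  have h11 : g 1 1 = r := by rw [← hg]; simp
  have hn : Complex.normSq r = 1 := by
    have : Complex.normSq r ^ 2 = 1 := by
      rw [← map_pow]
      simpa using congrArg Complex.normSq hr
    exact (pow_eq_one_iff_of_nonneg (Complex.normSq_nonneg r) two_ne_zero).1 this
  rw [MonoidHom.mem_ker]
  ext x
  · have hm : r * conj r = 1 := by rw [Complex.mul_conj, hn, Complex.ofReal_one]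
    simp only [MulAction.toPermHom_apply, MulAction.toPerm_apply, smul_z, num, denom, h00, h01,
      h10, h11, hn, Equiv.Perm.coe_one, id_eq, zero_mul, zero_add, add_zero, map_zero,
      mul_zero, Complex.ofReal_one, div_one]
    linear_combination x.z * hm
  · simp [smul_r, denom, h10, h11, hn]

/-- The action of `PSL₂(ℂ)` on hyperbolic 3-space. -/
instance : MulAction PSL2C HypSpace :=
  MulAction.compHom HypSpace
    (QuotientGroup.lift _ (MulAction.toPermHom SL(2, ℂ) HypSpace) center_le)

end HypSpace

/-- The action of `SL₂(ℂ)` on the Riemann sphere by Möbius transformations. -/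
def moebius : SL(2, ℂ) →* Equiv.Perm Sphere :=
  (MulAction.toPermHom (GL (Fin 2) ℂ) Sphere).comp Matrix.SpecialLinearGroup.toGL

theorem center_le_moebius : Subgroup.center SL(2, ℂ) ≤ moebius.ker := by
  intro g hg
  obtain ⟨r, hr, hg⟩ := Matrix.SpecialLinearGroup.mem_center_iff.1 hg
  have hr0 : r ≠ 0 := by rintro rfl; simp at hr
  have h00 : g 0 0 = r := by rw [← hg]; simp
  have h01 : g 0 1 = 0 := by rw [← hg]; simp
  have h10 : g 1 0 = 0 := by rw [← hg]; simp
  have h11 : g 1 1 = r := by rw [← hg]; simp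
  rw [MonoidHom.mem_ker]
  apply Equiv.ext
  intro x
  change (Matrix.SpecialLinearGroup.toGL g) • x = x
  induction x using OnePoint.rec with
  | infty => rw [OnePoint.smul_infty_eq_ite]; exact if_pos h10
  | coe z =>
    rw [OnePoint.smul_some_eq_ite]
    change (if g 1 0 * z + g 1 1 = 0 then (OnePoint.infty : Sphere)
      else (((g 0 0 * z + g 0 1) / (g 1 0 * z + g 1 1) : ℂ) : Sphere)) = _
    rw [h00, h01, h10, h11]
    simp [hr0]

/-- The action of `PSL₂(ℂ)` on the Riemann sphere by Möbius transformations. -/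
instance : MulAction PSL2C Sphere :=
  MulAction.compHom Sphere (QuotientGroup.lift _ moebius center_le_moebius)

/-! ### Limit sets and convex cocompact groups -/

/-- A family of points of hyperbolic 3-space converges to the boundary point `ξ` in the
compactification by the Riemann sphere; that compactification is the closure of the upper
half-space in the one-point compactification of `ℂ × ℝ`, with `z ∈ ℂ` seen as `(z, 0)`. -/
def TendsToBoundary {α : Type*} (u : α → HypSpace) (l : Filter α) (ξ : Sphere) : Prop :=
  Tendsto (fun n => ((u n).toProd : OnePoint (ℂ × ℝ))) l
    (𝓝 (OnePoint.map (fun z : ℂ => (z, (0 : ℝ))) ξ))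

/-- The limit set of `Γ`: all limits in the Riemann sphere of sequences in the orbit `Γ o`. -/
def limitSet (Γ : Subgroup PSL2C) : Set Sphere :=
  {ξ | ∃ g : ℕ → Γ, TendsToBoundary (fun n => (g n : PSL2C) • HypSpace.o) atTop ξ}

/-- A (geodesically) convex subset of hyperbolic 3-space: it contains with two points the geodesic
segment between them. -/
def IsHypConvex (C : Set HypSpace) : Prop :=
  ∀ x ∈ C, ∀ y ∈ C, ∀ z, HypSpace.hdist x z + HypSpace.hdist z y = HypSpace.hdist x y → z ∈ C

/-- `c : ℝ → ℍ³` is a (unit speed) geodesic line from `ξ` to `η`. -/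
def IsGeodesicLine (c : ℝ → HypSpace) (ξ η : Sphere) : Prop :=
  (∀ s t, HypSpace.hdist (c s) (c t) = |s - t|) ∧
    TendsToBoundary c atBot ξ ∧ TendsToBoundary c atTop η

/-- The convex hull in hyperbolic 3-space of a subset of the sphere at infinity: the smallest
closed convex set containing all geodesic lines with both end points in the subset. -/
def hypHull (L : Set Sphere) : Set HypSpace :=
  ⋂₀ {C | IsClosed C ∧ IsHypConvex C ∧
    ∀ ξ ∈ L, ∀ η ∈ L, ∀ c, IsGeodesicLine c ξ η → range c ⊆ C}

/-- `Γ` is discrete and its convex core `Γ \ hull(Λ_Γ)` is compact. -/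
def IsConvexCocompact (Γ : Subgroup PSL2C) : Prop :=
  DiscreteTopology Γ ∧
    IsCompact ((Quotient.mk (MulAction.orbitRel Γ HypSpace)) '' hypHull (limitSet Γ))

/-! ### Circles, tori and packings -/

/-- Circles in the Riemann sphere: Euclidean circles in `ℂ` and lines together with `∞`. -/
def IsCircle (C : Set Sphere) : Prop :=
  (∃ (c : ℂ) (R : ℝ), 0 < R ∧ C = (fun z : ℂ => (z : Sphere)) '' Metric.sphere c R) ∨
  (∃ p v : ℂ, v ≠ 0 ∧ C = insert OnePoint.infty
    ((fun z : ℂ => (z : Sphere)) '' range (fun t : ℝ => p + t * v)))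

/-- The unit circle `C₀ = {|z| = 1}`. -/
def unitCircle : Set Sphere := (fun z : ℂ => (z : Sphere)) '' Metric.sphere 0 1

/-- Convergence of subsets of the Riemann sphere in the Vietoris topology, which on closed
non-empty subsets is the topology of the Hausdorff distance. -/
def SetTendsto (u : ℕ → Set Sphere) (C : Set Sphere) : Prop :=
  Tendsto u atTop (@nhds _ (TopologicalSpace.vietoris Sphere) C)

/-- A circle packing is locally finite if no infinite sequence of (distinct) circles in it
converges to a circle. -/
def LocallyFiniteCircles (P : Set (Set Sphere)) : Prop :=
  ¬ ∃ u : ℕ → Set Sphere, Function.Injective u ∧ (∀ n, u n ∈ P) ∧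
    ∃ C, IsCircle C ∧ SetTendsto u C

/-- A torus is given by the tuple of its circles. -/
def IsTorus {d : ℕ} (T : Fin d → Set Sphere) : Prop := ∀ i, IsCircle (T i)

/-- The torus `T₀ = (C₀, …, C₀)`. -/
def torus₀ (d : ℕ) : Fin d → Set Sphere := fun _ => unitCircle

/-- A torus packing is locally finite if no infinite sequence of (distinct) tori in it converges
(circle by circle) to a torus. -/
def LocallyFiniteTori {d : ℕ} (P : Set (Fin d → Set Sphere)) : Prop :=
  ¬ ∃ u : ℕ → Fin d → Set Sphere, Function.Injective u ∧ (∀ n, u n ∈ P) ∧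
    ∃ T, IsTorus T ∧ ∀ i, SetTendsto (fun n => u n i) (T i)

/-! ### Self-joinings and admissibility -/

/-- The group `G = ∏ᵢ PSL₂(ℂ)`. -/
abbrev G (d : ℕ) : Type := Fin d → PSL2C

/-- The self-joining `Γ_ρ = {(ρ₁(g), …, ρ_d(g)) : g ∈ Γ}`. -/
def selfJoining {d : ℕ} {Γ : Subgroup PSL2C} (ρ : Fin d → Γ →* PSL2C) : Subgroup (G d) :=
  (MonoidHom.pi ρ).range

/-- The orbit `Γ_ρ T`. -/
def torusOrbit {d : ℕ} {Γ : Subgroup PSL2C} (ρ : Fin d → Γ →* PSL2C) (T : Fin d → Set Sphere) :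
    Set (Fin d → Set Sphere) :=
  {T' | ∃ γ ∈ selfJoining ρ, T' = fun i => γ i • T i}

/-- The real coordinates (real and imaginary parts of all matrix entries) of an element of
`∏ᵢ SL₂(ℂ)`. -/
def realCoords {d : ℕ} (g : Fin d → SL(2, ℂ)) : Fin d × Fin 2 × Fin 2 × Bool → ℝ :=
  fun q => if q.2.2.2 then (g q.1 q.2.1 q.2.2.1).im else (g q.1 q.2.1 q.2.2.1).re

/-- Zariski density in the real algebraic group `G = ∏ᵢ PSL₂(ℂ)`: every real polynomial in the real
and imaginary parts of the matrix entries that vanishes on the preimage of `S` in `∏ᵢ SL₂(ℂ)`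
vanishes everywhere on `∏ᵢ SL₂(ℂ)`. -/
def IsZariskiDense {d : ℕ} (S : Set (G d)) : Prop :=
  ∀ p : MvPolynomial (Fin d × Fin 2 × Fin 2 × Bool) ℝ,
    (∀ g : Fin d → SL(2, ℂ), (fun i => (g i : PSL2C)) ∈ S → MvPolynomial.eval (realCoords g) p = 0) →
      ∀ g : Fin d → SL(2, ℂ), MvPolynomial.eval (realCoords g) p = 0

/-- `f : Λ_Γ → Λ_{σ(Γ)}` is the boundary map of `σ`: a `σ`-equivariant homeomorphism. -/
def IsBoundaryMap {Γ : Subgroup PSL2C} (σ : Γ →* PSL2C) (f : limitSet Γ ≃ₜ limitSet σ.range) :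
    Prop :=
  ∀ (g : Γ) (ξ η : limitSet Γ), (η : Sphere) = (g : PSL2C) • (ξ : Sphere) →
    (f η : Sphere) = σ g • (f ξ : Sphere)

/-- A torus `T = (C₁, …, C_d)` is `Γ_ρ`-admissible if for each `i` the circle packing `ρᵢ(Γ) Cᵢ` is
locally finite and `fᵢ(C₁ ∩ Λ_Γ) = Cᵢ ∩ Λ_{ρᵢ(Γ)}`, where `fᵢ` is the `ρᵢ`-boundary map. -/
def IsAdmissibleTorus {d : ℕ} [NeZero d] {Γ : Subgroup PSL2C} (ρ : Fin d → Γ →* PSL2C)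
    (T : Fin d → Set Sphere) : Prop :=
  IsTorus T ∧ ∀ i,
    LocallyFiniteCircles {C | ∃ g : Γ, C = ρ i g • T i} ∧
    ∃ f : limitSet Γ ≃ₜ limitSet (ρ i).range, IsBoundaryMap (ρ i) f ∧
      (fun ξ => (f ξ : Sphere)) '' {ξ | (ξ : Sphere) ∈ T 0} = T i ∩ limitSet (ρ i).range

/-- A torus packing is `Γ_ρ`-admissible if it consists of finitely many `Γ_ρ`-orbits of
`Γ_ρ`-admissible tori and is locally finite. -/
def IsAdmissiblePacking {d : ℕ} [NeZero d] {Γ : Subgroup PSL2C} (ρ : Fin d → Γ →* PSL2C)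
    (P : Set (Fin d → Set Sphere)) : Prop :=
  (∃ S : Set (Fin d → Set Sphere), S.Finite ∧ (∀ T ∈ S, IsAdmissibleTorus ρ T) ∧
    P = ⋃ T ∈ S, torusOrbit ρ T) ∧
  LocallyFiniteTori P

/-! ### The subgroup `H`, the chamber `A⁺` and the quotients -/

/-- `H`, the stabilizer of `T₀` in `G`. -/
def H (d : ℕ) : Subgroup (G d) :=
  Subgroup.pi univ (fun i => MulAction.stabilizer PSL2C (torus₀ d i))

/-- The diagonal matrix `diag(e^{t/2}, e^{-t/2})`. -/
def diag (t : ℝ) : SL(2, ℂ) :=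
  ⟨!![(Real.exp (t / 2) : ℂ), 0; 0, (Real.exp (-t / 2) : ℂ)], by
    rw [Matrix.det_fin_two_of, ← Complex.ofReal_mul, ← Real.exp_add]
    simp [neg_div]⟩

/-- The chamber `A⁺ = {a_t : tᵢ ≥ 0 for all i}`. -/
def Aplus (d : ℕ) : Set (G d) :=
  {a | ∃ t : Fin d → ℝ, (∀ i, 0 ≤ t i) ∧ a = fun i => (diag (t i) : PSL2C)}

/-- The quotient `Δ \ L` of a group by left multiplication by a subgroup (with the quotient
topology). -/
abbrev LeftQuot {L : Type*} [Group L] (Δ : Subgroup L) : Type _ := MulAction.orbitRel.Quotient Δ L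

/-- The class `[g] = Δ g` in `Δ \ L`. -/
def leftClass {L : Type*} [Group L] (Δ : Subgroup L) (g : L) : LeftQuot Δ :=
  Quotient.mk (MulAction.orbitRel Δ L) g

/-- Bounded (i.e. relatively compact) subsets: those contained in a compact set. -/
def IsBoundedSubset {X : Type*} [TopologicalSpace X] (S : Set X) : Prop :=
  ∃ K, IsCompact K ∧ S ⊆ K

/-- The set of `[h] ∈ (Δ ∩ H) \ H` such that `[h] A⁺` meets `O ⊆ Δ \ G`. -/
def returnSet {d : ℕ} (Δ : Subgroup (G d)) (O : Set (LeftQuot Δ)) :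
    Set (LeftQuot (Δ.subgroupOf (H d))) :=
  {x | ∃ h : H d, x = leftClass (Δ.subgroupOf (H d)) h ∧
    ∃ a ∈ Aplus d, leftClass Δ ((h : G d) * a) ∈ O}

end TorusPacking

end

/-!
Everything is reduced to linear algebra in `SL₂(ℂ)` along a non-principal ultrafilter on `ℕ`. The
size `2 cosh d(o, g o)` of `g ∈ PSL₂(ℂ)` is the squared Frobenius norm of a matrix representing it.
If matrices `A n` diverge, their rescalings converge to a rank one matrix `u wᵀ` (`Attracts`): all
points of the Riemann sphere but one are attracted to the point `u`, and so is the orbit of `o`.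

Suppose that the set of returning classes is unbounded. Choose representatives `h n` of returning
classes with sizes tending to infinity that are almost minimal in their `(Γ_ρ ∩ H)`-orbits
(`exists_almost_minimal`), with `γ n ∈ Γ` such that `ρᵢ(γ n) h a_t` is bounded in each coordinate
`i`. The rays `h a_t` are orthogonal to the plane spanned by the unit circle. So if the starting
points `h n` diverge in the coordinate `i`, then the end points, and with them `ρᵢ(γ n)⁻¹ o`,
converge to the same point of the circle (`RaySystem.toSphere_eq`). If the starting points stay
bounded, then the end points stay away from the circle (`RaySystem.tendsto_matNormSq_of_mem`).

Some coordinate diverges, so `ρᵢ(γ n)⁻¹ o` converges there to a limit point on the circle.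
Boundary maps respect attracting points (`IsBoundaryMap.apply_attracting`, which needs three limit
points, provided by Zariski density), and by admissibility the images of this limit point lie on the
circle in all coordinates. Hence all coordinates of `h n` diverge, to the images `fᵢ(ξ)` of one limit
point `ξ` of `Γ`.

By convex cocompactness `ξ` is a conical limit point (`IsConvexCocompact.exists_conical`), a property
that the boundary maps transport to every coordinate (`IsBoundaryMap.not_tendsto`). The conical
sequence moves the torus to tori whose circles are all of definite size. As the packing is locally
finite, there are finitely many of these (`finite_tori_of_bounded`), so quotients of elements of the
sequence lie in `Γ_ρ ∩ H`. They contract the vectors representing `fᵢ(ξ)` as much as desired, in all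
coordinates at once (`exists_contracting`). Applying one of them to `h n` reduces the size of `h n`
by a factor of two, which contradicts almost minimality.
-/

noncomputable section

namespace TorusPacking

open Matrix

/-! ### Homogeneous coordinates on the Riemann sphere -/

/-- The squared Euclidean norm of a vector of `ℂ²`. -/
def vecNormSq (v : Fin 2 → ℂ) : ℝ := Complex.normSq (v 0) + Complex.normSq (v 1)

/-- The squared Frobenius norm of a `2 × 2` matrix. For `g ∈ SL₂(ℂ)` it is `2 cosh d(o, g o)`. -/
def matNormSq (M : Matrix (Fin 2) (Fin 2) ℂ) : ℝ :=
  Complex.normSq (M 0 0) + Complex.normSq (M 0 1) + Complex.normSq (M 1 0) + Complex.normSq (M 1 1)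

/-- The point of the Riemann sphere with homogeneous coordinates `(v₀ : v₁)`. The value `∞` at
`v = 0` is a junk value. -/
def toSphere (v : Fin 2 → ℂ) : Sphere :=
  if v 1 = 0 then OnePoint.infty else ((v 0 / v 1 : ℂ) : Sphere)

theorem vec_ne_zero_iff (v : Fin 2 → ℂ) : v ≠ 0 ↔ v 0 ≠ 0 ∨ v 1 ≠ 0 := by
  rw [Ne, funext_iff, Fin.forall_fin_two]
  simp only [Pi.zero_apply]
  tauto

theorem vecNormSq_nonneg (v : Fin 2 → ℂ) : 0 ≤ vecNormSq v :=
  add_nonneg (Complex.normSq_nonneg _) (Complex.normSq_nonneg _)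

theorem vecNormSq_pos {v : Fin 2 → ℂ} (hv : v ≠ 0) : 0 < vecNormSq v := by
  unfold vecNormSq
  rcases (vec_ne_zero_iff v).1 hv with h | h
  · exact add_pos_of_pos_of_nonneg (Complex.normSq_pos.2 h) (Complex.normSq_nonneg _)
  · exact add_pos_of_nonneg_of_pos (Complex.normSq_nonneg _) (Complex.normSq_pos.2 h)

theorem matNormSq_nonneg (M : Matrix (Fin 2) (Fin 2) ℂ) : 0 ≤ matNormSq M := by
  have := fun i j => Complex.normSq_nonneg (M i j)
  unfold matNormSq
  linarith [this 0 0, this 0 1, this 1 0, this 1 1]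

theorem continuous_vecNormSq : Continuous vecNormSq := by
  unfold vecNormSq
  exact (Complex.continuous_normSq.comp (continuous_apply 0)).add
    (Complex.continuous_normSq.comp (continuous_apply 1))

theorem continuous_matNormSq : Continuous matNormSq := by
  unfold matNormSq
  have h := fun i j => Complex.continuous_normSq.comp
    (continuous_id.matrix_elem (X := Matrix (Fin 2) (Fin 2) ℂ) i j)
  exact (((h 0 0).add (h 0 1)).add (h 1 0)).add (h 1 1)

theorem vecNormSq_smul (c : ℂ) (v : Fin 2 → ℂ) :
    vecNormSq (c • v) = Complex.normSq c * vecNormSq v := by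
  simp only [vecNormSq, Pi.smul_apply, smul_eq_mul, Complex.normSq_mul]
  ring

theorem matNormSq_smul (c : ℂ) (M : Matrix (Fin 2) (Fin 2) ℂ) :
    matNormSq (c • M) = Complex.normSq c * matNormSq M := by
  simp only [matNormSq, Matrix.smul_apply, smul_eq_mul, Complex.normSq_mul]
  ring

theorem mulVec_zero_apply (M : Matrix (Fin 2) (Fin 2) ℂ) (v : Fin 2 → ℂ) :
    (M *ᵥ v) 0 = M 0 0 * v 0 + M 0 1 * v 1 := by
  simp [Matrix.mulVec, dotProduct, Fin.sum_univ_two]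

theorem mulVec_one_apply (M : Matrix (Fin 2) (Fin 2) ℂ) (v : Fin 2 → ℂ) :
    (M *ᵥ v) 1 = M 1 0 * v 0 + M 1 1 * v 1 := by
  simp [Matrix.mulVec, dotProduct, Fin.sum_univ_two]

theorem normSq_mul_add_mul_le (a b x y : ℂ) : Complex.normSq (a * x + b * y) ≤
    (Complex.normSq a + Complex.normSq b) * (Complex.normSq x + Complex.normSq y) := by
  have h : (Complex.normSq a + Complex.normSq b) * (Complex.normSq x + Complex.normSq y) =
      Complex.normSq (a * x + b * y) + Complex.normSq (a * conj y - b * conj x) := by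
    simp only [Complex.normSq_apply, Complex.add_re, Complex.add_im, Complex.mul_re,
      Complex.mul_im, Complex.sub_re, Complex.sub_im, Complex.conj_re, Complex.conj_im]
    ring
  rw [h]
  linarith [Complex.normSq_nonneg (a * conj y - b * conj x)]

theorem vecNormSq_mulVec_le (M : Matrix (Fin 2) (Fin 2) ℂ) (v : Fin 2 → ℂ) :
    vecNormSq (M *ᵥ v) ≤ matNormSq M * vecNormSq v := by
  unfold vecNormSq matNormSq
  rw [mulVec_zero_apply, mulVec_one_apply]
  nlinarith [normSq_mul_add_mul_le (M 0 0) (M 0 1) (v 0) (v 1),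
    normSq_mul_add_mul_le (M 1 0) (M 1 1) (v 0) (v 1)]

theorem matNormSq_mul_le (M M' : Matrix (Fin 2) (Fin 2) ℂ) :
    matNormSq (M * M') ≤ matNormSq M * matNormSq M' := by
  simp only [matNormSq, Matrix.mul_apply, Fin.sum_univ_two]
  linarith [normSq_mul_add_mul_le (M 0 0) (M 0 1) (M' 0 0) (M' 1 0),
    normSq_mul_add_mul_le (M 1 0) (M 1 1) (M' 0 0) (M' 1 0),
    normSq_mul_add_mul_le (M 0 0) (M 0 1) (M' 0 1) (M' 1 1),
    normSq_mul_add_mul_le (M 1 0) (M 1 1) (M' 0 1) (M' 1 1)]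

theorem sl_det_eq (A : SL(2, ℂ)) : A.1 0 0 * A.1 1 1 - A.1 0 1 * A.1 1 0 = 1 :=
  HypSpace.det_eq A

theorem inv_val (A : SL(2, ℂ)) : (A⁻¹).1 = !![A.1 1 1, -A.1 0 1; -A.1 1 0, A.1 0 0] := by
  rw [Matrix.SpecialLinearGroup.coe_inv, Matrix.adjugate_fin_two]

theorem matNormSq_inv (A : SL(2, ℂ)) : matNormSq (A⁻¹).1 = matNormSq A.1 := by
  rw [inv_val]
  simp only [matNormSq, Matrix.of_apply, Matrix.cons_val', Matrix.cons_val_zero,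
    Matrix.cons_val_one, Matrix.cons_val_fin_one, Complex.normSq_neg]
  ring

theorem mulVec_inv_mulVec (A : SL(2, ℂ)) (v : Fin 2 → ℂ) : A.1 *ᵥ ((A⁻¹).1 *ᵥ v) = v := by
  rw [Matrix.mulVec_mulVec, ← Matrix.SpecialLinearGroup.coe_mul, mul_inv_cancel,
    Matrix.SpecialLinearGroup.coe_one, Matrix.one_mulVec]

theorem inv_mulVec_mulVec (A : SL(2, ℂ)) (v : Fin 2 → ℂ) : (A⁻¹).1 *ᵥ (A.1 *ᵥ v) = v := by
  simpa using mulVec_inv_mulVec A⁻¹ v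

theorem mulVec_ne_zero (A : SL(2, ℂ)) {v : Fin 2 → ℂ} (hv : v ≠ 0) : A.1 *ᵥ v ≠ 0 := by
  intro h
  apply hv
  rw [← inv_mulVec_mulVec A v, h, Matrix.mulVec_zero]

/-- The determinant of the pair of vectors `u`, `v`. -/
def wedge (u v : Fin 2 → ℂ) : ℂ := u 0 * v 1 - u 1 * v 0

theorem wedge_mulVec (A : SL(2, ℂ)) (u v : Fin 2 → ℂ) :
    wedge (A.1 *ᵥ u) (A.1 *ᵥ v) = wedge u v := by
  simp only [wedge, mulVec_zero_apply, mulVec_one_apply]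
  linear_combination (u 0 * v 1 - u 1 * v 0) * sl_det_eq A

theorem wedge_smul_smul (a b : ℂ) (u v : Fin 2 → ℂ) :
    wedge (a • u) (b • v) = a * b * wedge u v := by
  simp only [wedge, Pi.smul_apply, smul_eq_mul]
  ring

theorem matNormSq_pos (A : SL(2, ℂ)) : 0 < matNormSq A.1 := by
  have h := sl_det_eq A
  rcases (matNormSq_nonneg A.1).eq_or_lt with h0 | h0
  · exfalso
    have := fun i j => Complex.normSq_nonneg (A.1 i j)
    unfold matNormSq at h0
    have h1 : A.1 0 0 = 0 := Complex.normSq_eq_zero.1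
      (by linarith [this 0 0, this 0 1, this 1 0, this 1 1])
    have h2 : A.1 0 1 = 0 := Complex.normSq_eq_zero.1
      (by linarith [this 0 0, this 0 1, this 1 0, this 1 1])
    simp [h1, h2] at h
  · exact h0

theorem isCompact_matNormSq_le (C : ℝ) :
    IsCompact {M : Matrix (Fin 2) (Fin 2) ℂ | matNormSq M ≤ C} := by
  have hK : IsCompact (Set.pi univ fun _ : Fin 2 => Set.pi univ fun _ : Fin 2 =>
      Metric.closedBall (0 : ℂ) √C) :=
    isCompact_univ_pi fun _ => isCompact_univ_pi fun _ => isCompact_closedBall _ _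
  refine IsCompact.of_isClosed_subset (X := Matrix (Fin 2) (Fin 2) ℂ) hK
    (isClosed_le continuous_matNormSq continuous_const) ?_
  intro M hM i _ j _
  rw [mem_closedBall_zero_iff]
  apply Real.le_sqrt_of_sq_le
  rw [← Complex.normSq_eq_norm_sq]
  have := fun i j => Complex.normSq_nonneg (M i j)
  refine le_trans ?_ hM
  unfold matNormSq
  fin_cases i <;> fin_cases j <;>
    simp only [Fin.zero_eta, Fin.mk_one] <;>
    linarith [this 0 0, this 0 1, this 1 0, this 1 1]

theorem isCompact_sl_matNormSq_le (C : ℝ) : IsCompact {A : SL(2, ℂ) | matNormSq A.1 ≤ C} := by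
  have hcl : IsClosedEmbedding (Subtype.val : SL(2, ℂ) → Matrix (Fin 2) (Fin 2) ℂ) :=
    IsClosed.isClosedEmbedding_subtypeVal
      (isClosed_eq (continuous_id.matrix_det) continuous_const)
  exact hcl.isCompact_preimage (isCompact_matNormSq_le C)

theorem isCompact_vecNormSq_le (C : ℝ) : IsCompact {v : Fin 2 → ℂ | vecNormSq v ≤ C} := by
  have hK : IsCompact (Set.pi univ fun _ : Fin 2 => Metric.closedBall (0 : ℂ) √C) :=
    isCompact_univ_pi fun _ => isCompact_closedBall _ _
  refine hK.of_isClosed_subset (isClosed_le continuous_vecNormSq continuous_const) ?_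
  intro v hv i _
  rw [mem_closedBall_zero_iff]
  apply Real.le_sqrt_of_sq_le
  rw [← Complex.normSq_eq_norm_sq]
  have := fun i => Complex.normSq_nonneg (v i)
  refine le_trans ?_ hv
  unfold vecNormSq
  fin_cases i <;> simp only [Fin.zero_eta, Fin.mk_one] <;> linarith [this 0, this 1]

theorem exists_toSphere_eq (ξ : Sphere) : ∃ v : Fin 2 → ℂ, v ≠ 0 ∧ toSphere v = ξ := by
  induction ξ using OnePoint.rec with
  | infty => exact ⟨![1, 0], by simp, by simp [toSphere]⟩
  | coe z => exact ⟨![z, 1], by simp, by simp [toSphere]⟩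

theorem toSphere_eq_iff {u v : Fin 2 → ℂ} (hu : u ≠ 0) (hv : v ≠ 0) :
    toSphere u = toSphere v ↔ wedge u v = 0 := by
  rw [vec_ne_zero_iff] at hu hv
  unfold toSphere wedge
  by_cases h1 : u 1 = 0 <;> by_cases h2 : v 1 = 0
  · simp [h1, h2]
  · have : u 0 ≠ 0 := by tauto
    simp [h1, h2, this]
  · have : v 0 ≠ 0 := by tauto
    simp [h1, h2, this]
  · rw [if_neg h1, if_neg h2, OnePoint.coe_eq_coe, div_eq_div_iff h1 h2, sub_eq_zero,
      mul_comm (v 0)]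

theorem toSphere_smul {c : ℂ} (hc : c ≠ 0) (v : Fin 2 → ℂ) : toSphere (c • v) = toSphere v := by
  unfold toSphere
  simp only [Pi.smul_apply, smul_eq_mul, mul_eq_zero, hc, false_or]
  rw [mul_div_mul_left _ _ hc]

theorem smul_toSphere (A : SL(2, ℂ)) {v : Fin 2 → ℂ} (hv : v ≠ 0) :
    (A : PSL2C) • toSphere v = toSphere (A.1 *ᵥ v) := by
  change Matrix.SpecialLinearGroup.toGL A • toSphere v = _
  rw [vec_ne_zero_iff] at hv
  by_cases h1 : v 1 = 0
  · have h0 : v 0 ≠ 0 := by tauto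
    have e : toSphere v = OnePoint.infty := if_pos h1
    rw [e, OnePoint.smul_infty_eq_ite]
    change (if A.1 1 0 = 0 then (OnePoint.infty : Sphere) else ((A.1 0 0 / A.1 1 0 : ℂ) : Sphere)) = _
    unfold toSphere
    rw [mulVec_zero_apply, mulVec_one_apply, h1]
    by_cases hc : A.1 1 0 = 0
    · simp [hc]
    · simp only [hc, if_false, mul_zero, add_zero, mul_eq_zero, h0, or_self]
      rw [mul_div_mul_right _ _ h0]
  · have e : toSphere v = ((v 0 / v 1 : ℂ) : Sphere) := if_neg h1
    rw [e, OnePoint.smul_some_eq_ite]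
    change (if A.1 1 0 * (v 0 / v 1) + A.1 1 1 = 0 then (OnePoint.infty : Sphere)
      else (((A.1 0 0 * (v 0 / v 1) + A.1 0 1) / (A.1 1 0 * (v 0 / v 1) + A.1 1 1) : ℂ) : Sphere)) = _
    unfold toSphere
    rw [mulVec_zero_apply, mulVec_one_apply]
    have e1 : A.1 1 0 * v 0 + A.1 1 1 * v 1 = (A.1 1 0 * (v 0 / v 1) + A.1 1 1) * v 1 := by
      field_simp
    have e2 : A.1 0 0 * v 0 + A.1 0 1 * v 1 = (A.1 0 0 * (v 0 / v 1) + A.1 0 1) * v 1 := by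
      field_simp
    rw [e1, e2, mul_div_mul_right _ _ h1]
    simp only [mul_eq_zero, h1, or_false]

theorem continuousAt_toSphere {v : Fin 2 → ℂ} (hv : v ≠ 0) : ContinuousAt toSphere v := by
  have c0 : Continuous fun w : Fin 2 → ℂ => w 0 := continuous_apply 0
  have c1 : Continuous fun w : Fin 2 → ℂ => w 1 := continuous_apply 1
  by_cases h1 : v 1 = 0
  · have h0 : v 0 ≠ 0 := by rw [vec_ne_zero_iff] at hv; tauto
    have e : toSphere v = OnePoint.infty := if_pos h1
    rw [ContinuousAt, e]
    intro U hU
    rw [mem_map]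
    have hU' : ((↑) : ℂ → Sphere) ⁻¹' U ∈ coclosedCompact ℂ := by
      have := OnePoint.tendsto_coe_infty (X := ℂ)
      exact this hU
    rw [coclosedCompact_eq_cocompact, ← Metric.cobounded_eq_cocompact,
      ← comap_norm_atTop, mem_comap] at hU'
    obtain ⟨S, hS, hSU⟩ := hU'
    obtain ⟨R, hR⟩ := mem_atTop_sets.1 hS
    have hR0 : ‖v 1‖ * |R| < ‖v 0‖ := by simpa [h1] using h0
    have : ∀ᶠ w in 𝓝 v, ‖w 1‖ * |R| < ‖w 0‖ :=
      ((c1.norm.mul continuous_const).tendsto v).eventually_lt (c0.norm.tendsto v) hR0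
    filter_upwards [this] with w hw
    rw [mem_preimage]
    unfold toSphere
    split_ifs with hw1
    · exact mem_of_mem_nhds hU
    · apply hSU
      apply hR
      rw [norm_div]
      refine le_trans (le_abs_self R) ?_
      rw [le_div_iff₀ (norm_pos_iff.2 hw1)]
      linarith [mul_comm ‖w 1‖ |R|]
  · have hev : (fun w : Fin 2 → ℂ => ((w 0 / w 1 : ℂ) : Sphere)) =ᶠ[𝓝 v] toSphere := by
      filter_upwards [c1.continuousAt.eventually_ne h1] with w hw
      simp [toSphere, hw]
    refine ContinuousAt.congr ?_ hev
    exact OnePoint.continuous_coe.continuousAt.comp (c0.continuousAt.div c1.continuousAt h1)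

theorem toSphere_mem_unitCircle {v : Fin 2 → ℂ} (hv : v ≠ 0) :
    toSphere v ∈ unitCircle ↔ Complex.normSq (v 0) = Complex.normSq (v 1) := by
  unfold unitCircle toSphere
  by_cases h1 : v 1 = 0
  · have h0 : v 0 ≠ 0 := by rw [vec_ne_zero_iff] at hv; tauto
    simp [h1, h0]
  · have h2 : ‖v 1‖ ≠ 0 := norm_ne_zero_iff.2 h1
    rw [if_neg h1]
    constructor
    · rintro ⟨z, hz, he⟩
      rw [OnePoint.coe_eq_coe] at he
      rw [he, mem_sphere_zero_iff_norm, norm_div, div_eq_one_iff_eq h2] at hz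
      rw [Complex.normSq_eq_norm_sq, Complex.normSq_eq_norm_sq, hz]
    · intro h
      refine ⟨_, ?_, rfl⟩
      rw [Complex.normSq_eq_norm_sq, Complex.normSq_eq_norm_sq,
        sq_eq_sq₀ (norm_nonneg _) (norm_nonneg _)] at h
      rw [mem_sphere_zero_iff_norm, norm_div, h, div_self h2]

/-! ### The stabilizer of the unit circle -/

/-- The condition on the matrix entries of `A` that describes the stabilizer of the unit circle:
`A` multiplies the Hermitian form `|v₀|² - |v₁|²` by the sign `p`. -/
def PreservesForm (A : SL(2, ℂ)) : Prop :=
  ∃ p : ℝ, p ^ 2 = 1 ∧ A.1 1 1 = p * conj (A.1 0 0) ∧ A.1 0 1 = p * conj (A.1 1 0)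

theorem PreservesForm.normSq_sub {A : SL(2, ℂ)} (h : PreservesForm A) (v : Fin 2 → ℂ) :
    (Complex.normSq ((A.1 *ᵥ v) 0) - Complex.normSq ((A.1 *ᵥ v) 1)) ^ 2 =
      (Complex.normSq (v 0) - Complex.normSq (v 1)) ^ 2 := by
  obtain ⟨p, hp, h1, h2⟩ := h
  have hp0 : p ≠ 0 := by rintro rfl; norm_num at hp
  have hd := sl_det_eq A
  rw [h1, h2] at hd
  have hd' : p * (Complex.normSq (A.1 0 0) - Complex.normSq (A.1 1 0)) = 1 := by
    have : ((p * (Complex.normSq (A.1 0 0) - Complex.normSq (A.1 1 0)) : ℝ) : ℂ) = 1 := by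
      refine Eq.trans ?_ hd
      push_cast
      rw [← Complex.mul_conj, ← Complex.mul_conj]
      ring
    exact_mod_cast this
  have hn : Complex.normSq (A.1 0 0) - Complex.normSq (A.1 1 0) = p := by
    apply mul_left_cancel₀ hp0
    rw [hd', ← hp, sq]
  have key : Complex.normSq ((A.1 *ᵥ v) 0) - Complex.normSq ((A.1 *ᵥ v) 1) =
      p * (Complex.normSq (v 0) - Complex.normSq (v 1)) := by
    rw [mulVec_zero_apply, mulVec_one_apply, h1, h2]
    have e : ∀ a c x y : ℂ, Complex.normSq (a * x + p * conj c * y) -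
        Complex.normSq (c * x + p * conj a * y) =
        (Complex.normSq a - Complex.normSq c) * (Complex.normSq x - p ^ 2 * Complex.normSq y) := by
      intro a c x y
      simp only [Complex.normSq_apply, Complex.add_re, Complex.add_im, Complex.mul_re,
        Complex.mul_im, Complex.conj_re, Complex.conj_im, Complex.ofReal_re, Complex.ofReal_im]
      ring
    rw [e, hn, hp, one_mul]
  rw [key, mul_pow, hp, one_mul]

theorem PreservesForm.inv {A : SL(2, ℂ)} (h : PreservesForm A) : PreservesForm A⁻¹ := by
  obtain ⟨p, hp, h1, h2⟩ := h
  have hp' : (p : ℂ) * p = 1 := by rw [← sq]; exact_mod_cast hp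
  refine ⟨p, hp, ?_, ?_⟩ <;> rw [inv_val]
  · simp only [Matrix.of_apply, Matrix.cons_val', Matrix.cons_val_zero,
      Matrix.cons_val_one, Matrix.cons_val_fin_one, h1, map_mul, Complex.conj_conj,
      Complex.conj_ofReal]
    rw [← mul_assoc, hp', one_mul]
  · simp only [Matrix.of_apply, Matrix.cons_val', Matrix.cons_val_zero,
      Matrix.cons_val_one, Matrix.cons_val_fin_one, h2, map_neg, mul_neg]

/-- The two columns of an element of the stabilizer of the unit circle have the same norm. -/
theorem PreservesForm.normSq_columns {A : SL(2, ℂ)} (h : PreservesForm A) :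
    Complex.normSq (A.1 0 1) + Complex.normSq (A.1 1 1) =
      Complex.normSq (A.1 0 0) + Complex.normSq (A.1 1 0) := by
  obtain ⟨p, hp, h1, h2⟩ := h
  rw [h1, h2, Complex.normSq_mul, Complex.normSq_mul, Complex.normSq_conj, Complex.normSq_conj,
    Complex.normSq_ofReal, ← sq, hp]
  ring

theorem PreservesForm.smul_unitCircle_subset {A : SL(2, ℂ)} (h : PreservesForm A) :
    (A : PSL2C) • unitCircle ⊆ unitCircle := by
  rintro _ ⟨ξ, hξ, rfl⟩
  obtain ⟨v, hv, rfl⟩ := exists_toSphere_eq ξ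
  change (A : PSL2C) • toSphere v ∈ _
  rw [smul_toSphere A hv, toSphere_mem_unitCircle (mulVec_ne_zero A hv)]
  have := h.normSq_sub v
  rw [(toSphere_mem_unitCircle hv).1 hξ, sub_self, zero_pow two_ne_zero] at this
  exact sub_eq_zero.1 (pow_eq_zero_iff two_ne_zero |>.1 this)

theorem PreservesForm.smul_unitCircle {A : SL(2, ℂ)} (h : PreservesForm A) :
    (A : PSL2C) • unitCircle = unitCircle := by
  refine h.smul_unitCircle_subset.antisymm ?_
  rw [Set.subset_smul_set_iff]
  exact h.inv.smul_unitCircle_subset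

theorem preservesForm_of_smul_unitCircle {A : SL(2, ℂ)}
    (h : (A : PSL2C) • unitCircle = unitCircle) : PreservesForm A := by
  have key : ∀ z : ℂ, Complex.normSq z = 1 →
      Complex.normSq (A.1 0 0 * z + A.1 0 1) = Complex.normSq (A.1 1 0 * z + A.1 1 1) := by
    intro z hz
    have hv : (![z, 1] : Fin 2 → ℂ) ≠ 0 := by simp
    have hm : toSphere ![z, 1] ∈ unitCircle := by
      rw [toSphere_mem_unitCircle hv]; simpa using hz
    have := Set.smul_mem_smul_set (a := (A : PSL2C)) hm
    rw [h, smul_toSphere A hv, toSphere_mem_unitCircle (mulVec_ne_zero A hv), mulVec_zero_apply,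
      mulVec_one_apply] at this
    simpa using this
  -- four points of the circle determine the Hermitian form of the image
  have k1 := key 1 (by simp)
  have k2 := key (-1) (by simp)
  have k3 := key Complex.I (by simp)
  have k4 := key (-Complex.I) (by simp)
  have hd := sl_det_eq A
  unfold PreservesForm
  generalize A.1 0 0 = a at *
  generalize A.1 0 1 = b at *
  generalize A.1 1 0 = c at *
  generalize A.1 1 1 = d at *
  have hX : Complex.normSq a + Complex.normSq b = Complex.normSq c + Complex.normSq d := by
    simp only [Complex.normSq_apply, Complex.add_re, Complex.add_im, Complex.mul_re,
      Complex.mul_im, Complex.neg_re, Complex.neg_im, Complex.one_re, Complex.one_im] at k1 k2 ⊢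
    linarith
  have hY : conj a * b = conj c * d := by
    apply Complex.ext <;>
    simp only [Complex.normSq_apply, Complex.add_re, Complex.add_im, Complex.mul_re,
      Complex.mul_im, Complex.neg_re, Complex.neg_im, Complex.one_re, Complex.one_im,
      Complex.I_re, Complex.I_im, Complex.conj_re, Complex.conj_im] at k1 k2 k3 k4 ⊢ <;>
    linarith
  set p : ℝ := Complex.normSq a - Complex.normSq c with hp
  have hpc : (p : ℂ) = a * conj a - c * conj c := by
    rw [hp, Complex.mul_conj, Complex.mul_conj]; push_cast; ring
  have e1 : conj a = p * d := by
    rw [hpc]; linear_combination (-conj a) * hd - c * hY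
  have e2 : conj c = p * b := by
    rw [hpc]; linear_combination (-conj c) * hd - a * hY
  have n1 : Complex.normSq a = p ^ 2 * Complex.normSq d := by
    rw [← Complex.normSq_conj, e1, Complex.normSq_mul, Complex.normSq_ofReal, sq]
  have n2 : Complex.normSq c = p ^ 2 * Complex.normSq b := by
    rw [← Complex.normSq_conj, e2, Complex.normSq_mul, Complex.normSq_ofReal, sq]
  have hp0 : p ≠ 0 := by
    intro h0
    rw [h0, zero_pow two_ne_zero, zero_mul, Complex.normSq_eq_zero] at n1 n2
    simp [n1, n2] at hd
  have hp2 : p ^ 2 = 1 := by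
    apply mul_right_cancel₀ hp0
    have : Complex.normSq d - Complex.normSq b = p := by rw [hp]; linarith
    nlinarith
  have hpp : (p : ℂ) * p = 1 := by rw [← sq]; exact_mod_cast hp2
  refine ⟨p, hp2, ?_, ?_⟩
  · rw [e1, ← mul_assoc, hpp, one_mul]
  · rw [e2, ← mul_assoc, hpp, one_mul]

/-! ### The action on hyperbolic space and the size of group elements -/

theorem coe_smul_hyp (A : SL(2, ℂ)) (x : HypSpace) : (A : PSL2C) • x = A • x := rfl

/-- The function `(|z|² + r² + 1) / r = 2 cosh d(o, x)` on the upper half-space. -/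
def twoCosh (x : HypSpace) : ℝ := (Complex.normSq x.z + x.r ^ 2 + 1) / x.r

/-- The size `2 cosh d(o, g o)` of an element of `PSL₂(ℂ)`, which is the squared Frobenius norm of
a matrix representing it. -/
def sizeSq (g : PSL2C) : ℝ := twoCosh (g • HypSpace.o)

theorem denom_o (A : SL(2, ℂ)) :
    HypSpace.denom A HypSpace.o = Complex.normSq (A.1 1 0) + Complex.normSq (A.1 1 1) := by
  simp only [HypSpace.denom, HypSpace.o, mul_zero, zero_add, one_pow, mul_one]
  ring

theorem num_o (A : SL(2, ℂ)) : HypSpace.num A HypSpace.o =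
    A.1 0 0 * conj (A.1 1 0) + A.1 0 1 * conj (A.1 1 1) := by
  simp only [HypSpace.num, HypSpace.o, mul_zero, zero_add, Complex.ofReal_one, one_pow, mul_one]
  ring

theorem normSq_num_o (A : SL(2, ℂ)) : Complex.normSq (HypSpace.num A HypSpace.o) + 1 =
    HypSpace.denom A HypSpace.o * (Complex.normSq (A.1 0 0) + Complex.normSq (A.1 0 1)) := by
  have h := HypSpace.num_mul_conj A HypSpace.o
  simp only [HypSpace.o, mul_zero, zero_add, Complex.ofReal_one, one_pow, mul_one,
    Complex.mul_conj] at h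
  rw [add_comm (Complex.normSq (A.1 0 0))]
  exact_mod_cast h

theorem smul_o_z (A : SL(2, ℂ)) : (A • HypSpace.o).z =
    (A.1 0 0 * conj (A.1 1 0) + A.1 0 1 * conj (A.1 1 1)) /
      ((Complex.normSq (A.1 1 0) + Complex.normSq (A.1 1 1) : ℝ) : ℂ) := by
  rw [HypSpace.smul_z, num_o, denom_o]

theorem smul_o_r (A : SL(2, ℂ)) : (A • HypSpace.o).r =
    (Complex.normSq (A.1 1 0) + Complex.normSq (A.1 1 1))⁻¹ := by
  rw [HypSpace.smul_r, denom_o, inv_eq_one_div]; rfl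

theorem normSq_row_pos (A : SL(2, ℂ)) :
    0 < Complex.normSq (A.1 1 0) + Complex.normSq (A.1 1 1) := by
  rw [← denom_o]; exact HypSpace.denom_pos A _

theorem normSq_smul_o (A : SL(2, ℂ)) :
    Complex.normSq (A • HypSpace.o).z + (A • HypSpace.o).r ^ 2 =
      (Complex.normSq (A.1 0 0) + Complex.normSq (A.1 0 1)) /
        (Complex.normSq (A.1 1 0) + Complex.normSq (A.1 1 1)) := by
  have h := normSq_num_o A
  have hp := (normSq_row_pos A).ne'
  rw [smul_o_r, HypSpace.smul_z, denom_o, Complex.normSq_div, Complex.normSq_ofReal]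
  rw [denom_o] at h
  field_simp
  rw [h]

theorem sizeSq_coe (A : SL(2, ℂ)) : sizeSq (A : PSL2C) = matNormSq A.1 := by
  have hp := (normSq_row_pos A).ne'
  rw [sizeSq, twoCosh, coe_smul_hyp, normSq_smul_o, smul_o_r]
  unfold matNormSq
  field_simp
  ring

theorem sizeSq_pos (g : PSL2C) : 0 < sizeSq g := by
  obtain ⟨A, rfl⟩ := QuotientGroup.mk_surjective g
  exact (matNormSq_pos A).trans_eq (sizeSq_coe A).symm

theorem continuous_sl_entry (i j : Fin 2) : Continuous fun A : SL(2, ℂ) => A.1 i j :=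
  continuous_subtype_val.matrix_elem i j

theorem continuous_sizeSq : Continuous sizeSq := by
  rw [(QuotientGroup.isQuotientMap_mk _).continuous_iff]
  have : sizeSq ∘ (QuotientGroup.mk : SL(2, ℂ) → PSL2C) = fun A => matNormSq A.1 :=
    funext sizeSq_coe
  rw [this]
  exact continuous_matNormSq.comp continuous_subtype_val

theorem isCompact_sizeSq_le (C : ℝ) : IsCompact {g : PSL2C | sizeSq g ≤ C} := by
  have := (isCompact_sl_matNormSq_le C).image
    (QuotientGroup.continuous_mk (N := Subgroup.center SL(2, ℂ)))
  refine this.of_isClosed_subset (isClosed_le continuous_sizeSq continuous_const) ?_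
  intro g hg
  obtain ⟨A, rfl⟩ := QuotientGroup.mk_surjective g
  exact ⟨A, (sizeSq_coe A).symm.le.trans hg, rfl⟩

instance isClosed_center_sl : IsClosed ((Subgroup.center SL(2, ℂ) : Subgroup _) : Set SL(2, ℂ)) := by
  have : ((Subgroup.center SL(2, ℂ) : Subgroup _) : Set SL(2, ℂ)) = ⋂ g, {h | g * h = h * g} := by
    ext h
    simp [Subgroup.mem_center_iff]
  rw [this]
  exact isClosed_iInter fun g =>
    isClosed_eq (continuous_const.mul continuous_id) (continuous_id.mul continuous_const)

instance : T2Space PSL2C := inferInstance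

theorem finite_sizeSq_le (Γ : Subgroup PSL2C) [DiscreteTopology Γ] (C : ℝ) :
    {g : PSL2C | g ∈ Γ ∧ sizeSq g ≤ C}.Finite := by
  have hcl : IsClosed (Γ : Set PSL2C) := Subgroup.isClosed_of_discrete
  have hK : IsCompact ((Γ : Set PSL2C) ∩ {g | sizeSq g ≤ C}) :=
    (isCompact_sizeSq_le C).inter_left hcl
  have hd : IsDiscrete (Γ : Set PSL2C) := ⟨inferInstanceAs (DiscreteTopology Γ)⟩
  exact hK.finite (hd.mono inter_subset_left)

theorem continuous_smul_o_toProd : Continuous fun A : SL(2, ℂ) => (A • HypSpace.o).toProd := by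
  have h := continuous_sl_entry
  have hd : Continuous fun A : SL(2, ℂ) => Complex.normSq (A.1 1 0) + Complex.normSq (A.1 1 1) :=
    (Complex.continuous_normSq.comp (h 1 0)).add (Complex.continuous_normSq.comp (h 1 1))
  unfold HypSpace.toProd
  simp only [smul_o_z, smul_o_r]
  refine Continuous.prodMk ?_ (hd.inv₀ fun A => (normSq_row_pos A).ne')
  refine Continuous.div ?_ (Complex.continuous_ofReal.comp hd) fun A => ?_
  · exact ((h 0 0).mul (Complex.continuous_conj.comp (h 1 0))).add
      ((h 0 1).mul (Complex.continuous_conj.comp (h 1 1)))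
  · exact_mod_cast (normSq_row_pos A).ne'

theorem continuous_sl_smul (A : SL(2, ℂ)) : Continuous fun x : HypSpace => A • x := by
  have hp : Continuous HypSpace.toProd := continuous_induced_dom
  have hz : Continuous HypSpace.z := continuous_fst.comp hp
  have hr : Continuous HypSpace.r := continuous_snd.comp hp
  have hd : Continuous fun x : HypSpace => HypSpace.denom A x := by
    unfold HypSpace.denom
    exact (Complex.continuous_normSq.comp ((continuous_const.mul hz).add continuous_const)).add
      (continuous_const.mul (hr.pow 2))
  have hn : Continuous fun x : HypSpace => HypSpace.num A x := by
    unfold HypSpace.num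
    exact (((continuous_const.mul hz).add continuous_const).mul
      (Complex.continuous_conj.comp ((continuous_const.mul hz).add continuous_const))).add
      (continuous_const.mul ((Complex.continuous_ofReal.comp hr).pow 2))
  rw [continuous_induced_rng]
  exact (hn.div (Complex.continuous_ofReal.comp hd) fun x => HypSpace.denom_ne A x).prodMk
    (hr.div hd fun x => (HypSpace.denom_pos A x).ne')

instance (Γ : Subgroup PSL2C) : ContinuousConstSMul Γ HypSpace where
  continuous_const_smul γ := by
    obtain ⟨A, hA⟩ := QuotientGroup.mk_surjective (γ : PSL2C)
    have : (fun x : HypSpace => γ • x) = fun x => A • x := by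
      funext x
      change (γ : PSL2C) • x = _
      rw [← hA]; rfl
    rw [this]
    exact continuous_sl_smul A

theorem continuous_twoCosh : Continuous twoCosh := by
  have hp : Continuous HypSpace.toProd := continuous_induced_dom
  have hz : Continuous HypSpace.z := continuous_fst.comp hp
  have hr : Continuous HypSpace.r := continuous_snd.comp hp
  exact (((Complex.continuous_normSq.comp hz).add (hr.pow 2)).add continuous_const).div hr
    fun x => x.pos.ne'

/-! ### Attracting points of divergent sequences -/

/-- The matrices `A n ∈ SL₂(ℂ)` diverge along `l` and, after rescaling by positive factors, converge
to the rank one matrix `u wᵀ`. Then `u` is the attracting point and the kernel of `w` is the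
repelling point on the Riemann sphere. -/
def Attracts {ι : Type*} (l : Filter ι) (A : ι → SL(2, ℂ)) (u w : Fin 2 → ℂ) : Prop :=
  u ≠ 0 ∧ w ≠ 0 ∧ ∃ s : ι → ℝ, (∀ n, 0 < s n) ∧ Tendsto s l (𝓝 0) ∧
    Tendsto (fun n => (s n : ℂ) • (A n).1) l (𝓝 (vecMulVec u w))

theorem matNormSq_vecMulVec (u w : Fin 2 → ℂ) :
    matNormSq (vecMulVec u w) = vecNormSq u * vecNormSq w := by
  simp only [matNormSq, vecNormSq, vecMulVec_apply, Complex.normSq_mul]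
  ring

theorem exists_eq_vecMulVec {B : Matrix (Fin 2) (Fin 2) ℂ} (h0 : B ≠ 0)
    (hd : B 0 0 * B 1 1 - B 0 1 * B 1 0 = 0) :
    ∃ u w : Fin 2 → ℂ, u ≠ 0 ∧ w ≠ 0 ∧ B = vecMulVec u w := by
  have mk : ∀ u w : Fin 2 → ℂ, B = vecMulVec u w →
      ∃ u w : Fin 2 → ℂ, u ≠ 0 ∧ w ≠ 0 ∧ B = vecMulVec u w := by
    intro u w h
    refine ⟨u, w, ?_, ?_, h⟩
    · rintro rfl; exact h0 (by rw [h, zero_vecMulVec])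
    · rintro rfl; exact h0 (by rw [h, vecMulVec_zero])
  by_cases h00 : B 0 0 = 0
  · by_cases h01 : B 0 1 = 0
    · apply mk ![0, 1] (B 1)
      ext i j
      fin_cases i <;> fin_cases j <;> simp [vecMulVec_apply, h00, h01]
    · apply mk ![1, B 1 1 / B 0 1] (B 0)
      have h10 : B 1 0 = 0 := by simpa [h00, h01] using hd
      ext i j
      fin_cases i <;> fin_cases j <;> simp [vecMulVec_apply, h00, h01, h10]
  · apply mk ![1, B 1 0 / B 0 0] (B 0)
    have : B 1 0 / B 0 0 * B 0 1 = B 1 1 := by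
      field_simp; linear_combination -hd
    ext i j
    fin_cases i <;> fin_cases j <;> simp [vecMulVec_apply, h00, this]

theorem exists_attracts {ι : Type*} (l : Ultrafilter ι) {A : ι → SL(2, ℂ)}
    (h : Tendsto (fun n => matNormSq (A n).1) l atTop) : ∃ u w, Attracts l A u w := by
  set s : ι → ℝ := fun n => (√(matNormSq (A n).1))⁻¹ with hs
  have hsq : ∀ n, s n ^ 2 * matNormSq (A n).1 = 1 := by
    intro n
    rw [hs]
    simp only
    rw [inv_pow, Real.sq_sqrt (matNormSq_nonneg _), inv_mul_cancel₀ (matNormSq_pos _).ne']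
  have hs0 : Tendsto s l (𝓝 0) := (Real.tendsto_sqrt_atTop.comp h).inv_tendsto_atTop
  have hN : ∀ n, matNormSq ((s n : ℂ) • (A n).1) = 1 := by
    intro n
    rw [matNormSq_smul, Complex.normSq_ofReal, ← sq, hsq]
  have hcpt := isCompact_matNormSq_le 1
  obtain ⟨B, -, hB⟩ := hcpt.ultrafilter_le_nhds (l.map fun n => (s n : ℂ) • (A n).1) (by
    rw [le_principal_iff]
    exact Eventually.of_forall (f := (l : Filter ι)) fun n => (hN n).le)
  have hB' : Tendsto (fun n => (s n : ℂ) • (A n).1) l (𝓝 B) := hB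
  have h1 : matNormSq B = 1 := by
    refine tendsto_nhds_unique ((continuous_matNormSq.tendsto B).comp hB') ?_
    exact tendsto_const_nhds.congr fun n => (hN n).symm
  have hent : ∀ i j, Tendsto (fun n => (s n : ℂ) * (A n).1 i j) l (𝓝 (B i j)) := fun i j =>
    ((continuous_id.matrix_elem (X := Matrix (Fin 2) (Fin 2) ℂ) i j).tendsto B).comp hB'
  have hdet : B 0 0 * B 1 1 - B 0 1 * B 1 0 = 0 := by
    refine tendsto_nhds_unique (((hent 0 0).mul (hent 1 1)).sub ((hent 0 1).mul (hent 1 0))) ?_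
    have : Tendsto (fun n => ((s n : ℂ)) ^ 2) l (𝓝 0) := by
      have := ((Complex.continuous_ofReal.tendsto 0).comp hs0).pow 2
      simpa using this
    refine this.congr fun n => ?_
    linear_combination (-(s n : ℂ) ^ 2) * sl_det_eq (A n)
  obtain ⟨u, w, hu, hw, rfl⟩ := exists_eq_vecMulVec (B := B)
    (by rintro rfl; simp [matNormSq] at h1) hdet
  exact ⟨u, w, hu, hw, s, fun n => inv_pos.2 (Real.sqrt_pos.2 (matNormSq_pos _)), hs0, hB'⟩

theorem tendsto_smul_mulVec {ι : Type*} {l : Filter ι} {A : ι → SL(2, ℂ)}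
    {s : ι → ℝ} {B : Matrix (Fin 2) (Fin 2) ℂ}
    (hA : Tendsto (fun n => (s n : ℂ) • (A n).1) l (𝓝 B))
    {v : ι → Fin 2 → ℂ} {v₀ : Fin 2 → ℂ} (hv : Tendsto v l (𝓝 v₀)) :
    Tendsto (fun n => (s n : ℂ) • ((A n).1 *ᵥ v n)) l (𝓝 (B *ᵥ v₀)) := by
  have hc : Continuous fun p : Matrix (Fin 2) (Fin 2) ℂ × (Fin 2 → ℂ) => p.1 *ᵥ p.2 :=
    continuous_fst.matrix_mulVec continuous_snd
  have := (hc.tendsto (B, v₀)).comp (hA.prodMk_nhds hv)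
  refine this.congr fun n => ?_
  simp only [Function.comp, smul_mulVec]

theorem vecMulVec_mulVec_eq (u w v : Fin 2 → ℂ) :
    vecMulVec u w *ᵥ v = (w ⬝ᵥ v) • u := by
  ext i
  simp only [mulVec, dotProduct, vecMulVec_apply, Fin.sum_univ_two, Pi.smul_apply, smul_eq_mul]
  ring

namespace Attracts

variable {ι : Type*} {l : Filter ι} {A : ι → SL(2, ℂ)} {u w : Fin 2 → ℂ}

theorem tendsto_matNormSq (h : Attracts l A u w) :
    Tendsto (fun n => matNormSq (A n).1) l atTop := by
  obtain ⟨hu, hw, s, hs, hs0, hA⟩ := h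
  have h1 : Tendsto (fun n => s n ^ 2 * matNormSq (A n).1) l (𝓝 (vecNormSq u * vecNormSq w)) := by
    have := (continuous_matNormSq.tendsto _).comp hA
    rw [matNormSq_vecMulVec] at this
    refine this.congr fun n => ?_
    simp only [Function.comp, matNormSq_smul, Complex.normSq_ofReal]
    ring
  have h2 : Tendsto (fun n => (s n ^ 2)⁻¹) l atTop := by
    apply Tendsto.inv_tendsto_nhdsGT_zero
    rw [tendsto_nhdsWithin_iff]
    refine ⟨by simpa using hs0.pow 2, Eventually.of_forall fun n => pow_pos (hs n) 2⟩
  refine (h2.atTop_mul_pos (mul_pos (vecNormSq_pos hu) (vecNormSq_pos hw)) h1).congr fun n => ?_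
  rw [← mul_assoc, inv_mul_cancel₀ (pow_pos (hs n) 2).ne', one_mul]

theorem smul_left (h : Attracts l A u w) (g : SL(2, ℂ)) :
    Attracts l (fun n => g * A n) (g.1 *ᵥ u) w := by
  obtain ⟨hu, hw, s, hs, hs0, hA⟩ := h
  refine ⟨mulVec_ne_zero g hu, hw, s, hs, hs0, ?_⟩
  have hc : Continuous fun M : Matrix (Fin 2) (Fin 2) ℂ => g.1 * M :=
    continuous_const.matrix_mul continuous_id
  have := (hc.tendsto _).comp hA
  rw [mul_vecMulVec] at this
  refine this.congr fun n => ?_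
  simp only [Function.comp, Matrix.SpecialLinearGroup.coe_mul, Matrix.mul_smul]

theorem tendsto_toSphere (h : Attracts l A u w) {v : ι → Fin 2 → ℂ} {v₀ : Fin 2 → ℂ}
    (hv : Tendsto v l (𝓝 v₀)) (hw : w ⬝ᵥ v₀ ≠ 0) :
    Tendsto (fun n => toSphere ((A n).1 *ᵥ v n)) l (𝓝 (toSphere u)) := by
  obtain ⟨hu, -, s, hs, hs0, hA⟩ := h
  have h1 := tendsto_smul_mulVec hA hv
  rw [vecMulVec_mulVec_eq] at h1
  have h2 := (continuousAt_toSphere (smul_ne_zero hw hu)).tendsto.comp h1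
  rw [toSphere_smul hw] at h2
  refine h2.congr fun n => ?_
  exact toSphere_smul (Complex.ofReal_ne_zero.2 (hs n).ne') _

theorem tendsto_smul (h : Attracts l A u w) {v : Fin 2 → ℂ} (hw : w ⬝ᵥ v ≠ 0) :
    Tendsto (fun n => (A n : PSL2C) • toSphere v) l (𝓝 (toSphere u)) := by
  have hv : v ≠ 0 := by rintro rfl; simp at hw
  simp only [smul_toSphere _ hv]
  exact h.tendsto_toSphere tendsto_const_nhds hw

/-- The entries of `A n (A n)*`, which give the coordinates of `A n o`, converge after rescaling to
those of `u u*`. -/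
theorem tendsto_rows (h : Attracts l A u w) : ∃ s : ι → ℝ, (∀ n, 0 < s n) ∧ Tendsto s l (𝓝 0) ∧
    Tendsto (fun n => s n * (Complex.normSq ((A n).1 0 0) + Complex.normSq ((A n).1 0 1))) l
      (𝓝 (Complex.normSq (u 0))) ∧
    Tendsto (fun n => s n * (Complex.normSq ((A n).1 1 0) + Complex.normSq ((A n).1 1 1))) l
      (𝓝 (Complex.normSq (u 1))) ∧
    Tendsto (fun n => (s n : ℂ) * ((A n).1 0 0 * conj ((A n).1 1 0) +
      (A n).1 0 1 * conj ((A n).1 1 1))) l (𝓝 (u 0 * conj (u 1))) := by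
  obtain ⟨hu, hw, s, hs, hs0, hA⟩ := h
  have hW := vecNormSq_pos hw
  have hent : ∀ i j, Tendsto (fun n => (s n : ℂ) * (A n).1 i j) l (𝓝 (u i * w j)) := fun i j =>
    ((continuous_id.matrix_elem (X := Matrix (Fin 2) (Fin 2) ℂ) i j).tendsto _).comp hA
  have hrow : ∀ i, Tendsto (fun n => s n ^ 2 / vecNormSq w *
      (Complex.normSq ((A n).1 i 0) + Complex.normSq ((A n).1 i 1))) l
      (𝓝 (Complex.normSq (u i))) := by
    intro i
    have := ((((Complex.continuous_normSq.tendsto _).comp (hent i 0)).add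
      ((Complex.continuous_normSq.tendsto _).comp (hent i 1))).div_const (vecNormSq w))
    rw [Complex.normSq_mul, Complex.normSq_mul, ← mul_add] at this
    change Tendsto _ _ (𝓝 (_ * vecNormSq w / vecNormSq w)) at this
    rw [mul_div_cancel_right₀ _ hW.ne'] at this
    refine this.congr fun n => ?_
    simp only [Function.comp, Complex.normSq_mul, Complex.normSq_ofReal]
    ring
  refine ⟨fun n => s n ^ 2 / vecNormSq w, fun n => div_pos (pow_pos (hs n) 2) hW, ?_,
    hrow 0, hrow 1, ?_⟩
  · simpa using (hs0.pow 2).div_const (vecNormSq w)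
  · have hc := fun i j => (Complex.continuous_conj.tendsto _).comp (hent i j)
    have := (((hent 0 0).mul (hc 1 0)).add ((hent 0 1).mul (hc 1 1))).div_const (vecNormSq w : ℂ)
    have hW' : (vecNormSq w : ℂ) ≠ 0 := Complex.ofReal_ne_zero.2 hW.ne'
    have e : (u 0 * w 0 * conj (u 1 * w 0) + u 0 * w 1 * conj (u 1 * w 1)) / (vecNormSq w : ℂ) =
        u 0 * conj (u 1) := by
      rw [div_eq_iff hW', vecNormSq, Complex.ofReal_add, ← Complex.mul_conj, ← Complex.mul_conj,
        map_mul, map_mul]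
      ring
    rw [e] at this
    refine this.congr fun n => ?_
    simp only [Function.comp, map_mul, Complex.conj_ofReal]
    push_cast
    ring

/-- The orbit of the base point converges to the attracting point. -/
theorem tendsToBoundary (h : Attracts l A u w) :
    TendsToBoundary (fun n => (A n : PSL2C) • HypSpace.o) l (toSphere u) := by
  obtain ⟨s, hs, hs0, h0, h1, hz⟩ := h.tendsto_rows
  have hu := (vec_ne_zero_iff u).1 h.1
  unfold TendsToBoundary
  simp only [coe_smul_hyp]
  by_cases hu1 : u 1 = 0
  · have hu0 : u 0 ≠ 0 := by tauto
    have e : toSphere u = OnePoint.infty := if_pos hu1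
    rw [e, OnePoint.map_infty]
    rw [hu1, map_zero] at h1
    have hratio : Tendsto (fun n => Complex.normSq (A n • HypSpace.o).z +
        (A n • HypSpace.o).r ^ 2) l atTop := by
      have h1' : Tendsto (fun n => (s n * (Complex.normSq ((A n).1 1 0) +
          Complex.normSq ((A n).1 1 1)))⁻¹) l atTop := by
        apply Tendsto.inv_tendsto_nhdsGT_zero
        rw [tendsto_nhdsWithin_iff]
        exact ⟨h1, Eventually.of_forall fun n => mul_pos (hs n) (normSq_row_pos _)⟩
      refine (h1'.atTop_mul_pos (Complex.normSq_pos.2 hu0) h0).congr fun n => ?_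
      rw [normSq_smul_o]
      have := (hs n).ne'
      have := (normSq_row_pos (A n)).ne'
      field_simp
    have hn : Tendsto (fun n => ‖(A n • HypSpace.o).toProd‖) l atTop := by
      rw [tendsto_atTop]
      intro C
      filter_upwards [hratio.eventually_ge_atTop (2 * C ^ 2 + 1)] with n hn
      by_contra! hlt
      have a1 : ‖(A n • HypSpace.o).z‖ ≤ ‖(A n • HypSpace.o).toProd‖ := norm_fst_le (A n • HypSpace.o).toProd
      have a2 : ‖(A n • HypSpace.o).r‖ ≤ ‖(A n • HypSpace.o).toProd‖ := norm_snd_le (A n • HypSpace.o).toProd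
      rw [Real.norm_eq_abs] at a2
      rw [Complex.normSq_eq_norm_sq, ← sq_abs (A n • HypSpace.o).r] at hn
      have a3 := norm_nonneg (A n • HypSpace.o).z
      have a4 := abs_nonneg (A n • HypSpace.o).r
      nlinarith
    rw [tendsto_norm_atTop_iff_cobounded, Metric.cobounded_eq_cocompact,
      ← coclosedCompact_eq_cocompact] at hn
    exact OnePoint.tendsto_coe_infty.comp hn
  · have e : toSphere u = ((u 0 / u 1 : ℂ) : Sphere) := if_neg hu1
    rw [e, OnePoint.map_some]
    refine (OnePoint.continuous_coe.tendsto _).comp ?_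
    have hpos := Complex.normSq_pos.2 hu1
    refine Tendsto.prodMk_nhds ?_ ?_
    · have hd := (Complex.continuous_ofReal.tendsto _).comp h1
      have := hz.div hd (Complex.ofReal_ne_zero.2 hpos.ne')
      have e2 : u 0 * conj (u 1) / (Complex.normSq (u 1) : ℂ) = u 0 / u 1 := by
        have hc : conj (u 1) ≠ 0 := by simpa using hu1
        rw [← Complex.mul_conj]
        field_simp
      rw [e2] at this
      refine this.congr fun n => ?_
      rw [smul_o_z]
      change _ / ((s n * _ : ℝ) : ℂ) = _
      rw [Complex.ofReal_mul, mul_div_mul_left _ _ (Complex.ofReal_ne_zero.2 (hs n).ne')]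
    · have := hs0.mul (h1.inv₀ hpos.ne')
      rw [zero_mul] at this
      refine this.congr fun n => ?_
      rw [smul_o_r, mul_inv, ← mul_assoc, mul_inv_cancel₀ (hs n).ne', one_mul]

theorem comp {κ : Type*} {l' : Filter κ} {x : κ → ι} (h : Attracts l A u w)
    (hx : Tendsto x l' l) : Attracts l' (A ∘ x) u w := by
  obtain ⟨hu, hw, s, hs, hs0, hA⟩ := h
  exact ⟨hu, hw, s ∘ x, fun n => hs _, hs0.comp hx, hA.comp hx⟩

theorem exists_seq [l.NeBot] (h : Attracts l A u w) :
    ∃ x : ℕ → ι, Attracts atTop (A ∘ x) u w := by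
  obtain ⟨hu, hw, s, hs, hs0, hA⟩ := h
  let X := ℝ × (Fin 2 → Fin 2 → ℂ)
  let f : ι → X := fun n => (s n, (s n : ℂ) • (A n).1)
  have hf : Tendsto f l (𝓝 ((0, vecMulVec u w) : X)) := Tendsto.prodMk_nhds hs0 hA
  have hne : (comap f (𝓝 ((0, vecMulVec u w) : X))).NeBot :=
    NeBot.mono ‹_› (tendsto_iff_comap.1 hf)
  obtain ⟨x, hx⟩ := exists_seq_tendsto (comap f (𝓝 ((0, vecMulVec u w) : X)))
  have hfx : Tendsto (f ∘ x) atTop (𝓝 ((0, vecMulVec u w) : X)) := tendsto_comap_iff.1 hx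
  exact ⟨x, hu, hw, s ∘ x, fun n => hs _, (continuous_fst.tendsto _).comp hfx,
    (continuous_snd.tendsto _).comp hfx⟩

/-- The attracting point of a divergent family of elements of `Γ` is a limit point of `Γ`. -/
theorem mem_limitSet [l.NeBot] (h : Attracts l A u w) {Γ : Subgroup PSL2C}
    (hA : ∀ n, (A n : PSL2C) ∈ Γ) : toSphere u ∈ limitSet Γ := by
  obtain ⟨x, hx⟩ := h.exists_seq
  exact ⟨fun n => ⟨A (x n), hA _⟩, hx.tendsToBoundary⟩

theorem eq_of_tendsToBoundary [l.NeBot] (h : Attracts l A u w) {ξ : Sphere}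
    (hξ : TendsToBoundary (fun n => (A n : PSL2C) • HypSpace.o) l ξ) : toSphere u = ξ := by
  have e := tendsto_nhds_unique h.tendsToBoundary hξ
  have inj : Function.Injective fun z : ℂ => (z, (0 : ℝ)) := fun a b hab => (Prod.ext_iff.1 hab).1
  exact (Option.map_injective inj) e

end Attracts

/-- Along an ultrafilter, a real function either tends to infinity or is bounded above. -/
theorem exists_bound_of_not_tendsto {ι : Type*} (l : Ultrafilter ι) {N : ι → ℝ}
    (h : ¬ Tendsto N l atTop) : ∃ C, ∀ᶠ n in (l : Filter ι), N n ≤ C := by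
  rw [tendsto_atTop] at h
  push Not at h
  obtain ⟨C, hC⟩ := h
  refine ⟨C, ?_⟩
  filter_upwards [hC] with n hn
  exact hn.le

theorem exists_tendsto_of_matNormSq_le {ι : Type*} (l : Ultrafilter ι) {A : ι → SL(2, ℂ)} {C : ℝ}
    (h : ∀ᶠ n in (l : Filter ι), matNormSq (A n).1 ≤ C) : ∃ B, Tendsto A l (𝓝 B) := by
  obtain ⟨B, -, hB⟩ := (isCompact_sl_matNormSq_le C).ultrafilter_le_nhds (l.map A) (by
    rw [le_principal_iff]; exact h)
  exact ⟨B, hB⟩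

/-- Otherwise a limit `B` of the matrices would send `o` to a boundary point. -/
theorem tendsto_matNormSq_of_tendsToBoundary {ι : Type*} (l : Ultrafilter ι) {A : ι → SL(2, ℂ)}
    {ξ : Sphere} (h : TendsToBoundary (fun n => (A n : PSL2C) • HypSpace.o) l ξ) :
    Tendsto (fun n => matNormSq (A n).1) l atTop := by
  by_contra hcon
  obtain ⟨C, hC⟩ := exists_bound_of_not_tendsto l hcon
  obtain ⟨B, hB⟩ := exists_tendsto_of_matNormSq_le l hC
  have h1 : Tendsto (fun n => (((A n • HypSpace.o).toProd : ℂ × ℝ) : OnePoint (ℂ × ℝ))) l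
      (𝓝 ((B • HypSpace.o).toProd : OnePoint (ℂ × ℝ))) :=
    (OnePoint.continuous_coe.tendsto _).comp ((continuous_smul_o_toProd.tendsto B).comp hB)
  have e := tendsto_nhds_unique h1 h
  induction ξ using OnePoint.rec with
  | infty =>
    rw [OnePoint.map_infty] at e
    exact OnePoint.coe_ne_infty _ e
  | coe z =>
    rw [OnePoint.map_some, OnePoint.coe_eq_coe] at e
    exact (B • HypSpace.o).pos.ne' (Prod.ext_iff.1 e).2

/-- Every limit point is the attracting point of a divergent sequence of matrices. -/
theorem exists_attracts_of_mem_limitSet {Γ : Subgroup PSL2C} {ξ : Sphere} (hξ : ξ ∈ limitSet Γ) :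
    ∃ (A : ℕ → SL(2, ℂ)) (u w : Fin 2 → ℂ), (∀ n, (A n : PSL2C) ∈ Γ) ∧
      Attracts (hyperfilter ℕ : Filter ℕ) A u w ∧ toSphere u = ξ := by
  obtain ⟨g, hg⟩ := hξ
  choose A hA using fun n => QuotientGroup.mk_surjective (g n : PSL2C)
  have hg' : TendsToBoundary (fun n => (A n : PSL2C) • HypSpace.o) (hyperfilter ℕ : Filter ℕ) ξ := by
    have hle : (hyperfilter ℕ : Filter ℕ) ≤ atTop := by
      rw [← Nat.cofinite_eq_atTop]; exact hyperfilter_le_cofinite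
    refine Tendsto.mono_left ?_ hle
    refine Tendsto.congr (fun n => ?_) hg
    simp only
    rw [← hA]
  obtain ⟨u, w, huw⟩ := exists_attracts _ (tendsto_matNormSq_of_tendsToBoundary _ hg')
  refine ⟨A, u, w, fun n => ?_, huw, huw.eq_of_tendsToBoundary hg'⟩
  have e : (A n : PSL2C) = g n := hA n
  rw [e]
  exact (g n).2

theorem smul_mem_limitSet {Γ : Subgroup PSL2C} {g : PSL2C} (hg : g ∈ Γ) {ξ : Sphere}
    (hξ : ξ ∈ limitSet Γ) : g • ξ ∈ limitSet Γ := by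
  obtain ⟨A, u, w, hA, h, rfl⟩ := exists_attracts_of_mem_limitSet hξ
  obtain ⟨B, rfl⟩ := QuotientGroup.mk_surjective g
  have e : ((B : SL(2, ℂ)) : PSL2C) • toSphere u = toSphere (B.1 *ᵥ u) := smul_toSphere B h.1
  refine e ▸ (h.smul_left B).mem_limitSet (Γ := Γ) fun n => ?_
  rw [QuotientGroup.mk_mul]
  exact mul_mem hg (hA n)

/-! ### Boundary maps and attracting points -/

theorem exists_kernel {w : Fin 2 → ℂ} (hw : w ≠ 0) :
    ∃ p : Sphere, ∀ v : Fin 2 → ℂ, v ≠ 0 → toSphere v ≠ p → w ⬝ᵥ v ≠ 0 := by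
  have hp : (![w 1, -w 0] : Fin 2 → ℂ) ≠ 0 := by
    rw [vec_ne_zero_iff] at hw ⊢
    simpa [or_comm] using hw
  refine ⟨toSphere ![w 1, -w 0], fun v hv hne h => hne ?_⟩
  rw [toSphere_eq_iff hv hp]
  rw [dotProduct, Fin.sum_univ_two] at h
  simp only [wedge, cons_val_zero, cons_val_one]
  linear_combination -h

/-- A divergent family attracts all points but one. -/
theorem Attracts.exists_repelling {ι : Type*} {l : Filter ι} {A : ι → SL(2, ℂ)} {u w : Fin 2 → ℂ}
    (h : Attracts l A u w) :
    ∃ p : Sphere, ∀ ξ ≠ p, Tendsto (fun n => (A n : PSL2C) • ξ) l (𝓝 (toSphere u)) := by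
  obtain ⟨p, hp⟩ := exists_kernel h.2.1
  refine ⟨p, fun ξ hξ => ?_⟩
  obtain ⟨v, hv, rfl⟩ := exists_toSphere_eq ξ
  exact h.tendsto_smul (hp v hv hξ)

/-- A boundary map sends the attracting point of a divergent family in `Γ` to the attracting point
of its image: some limit point avoids both repelling points, and its images converge to the
attracting points on both sides. -/
theorem IsBoundaryMap.apply_attracting {Γ : Subgroup PSL2C} {σ : Γ →* PSL2C}
    {f : limitSet Γ ≃ₜ limitSet σ.range} (hf : IsBoundaryMap σ f)
    (h3 : ∃ x : Fin 3 → limitSet Γ, Function.Injective x)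
    {ι : Type*} {l : Filter ι} [l.NeBot] {γ : ι → Γ} {A B : ι → SL(2, ℂ)}
    (hA : ∀ n, (A n : PSL2C) = γ n) (hB : ∀ n, (B n : PSL2C) = σ (γ n))
    {u w u' w' : Fin 2 → ℂ} (h : Attracts l A u w) (h' : Attracts l B u' w')
    (η : limitSet Γ) (hη : (η : Sphere) = toSphere u) : (f η : Sphere) = toSphere u' := by
  obtain ⟨p, hp⟩ := h.exists_repelling
  obtain ⟨p', hp'⟩ := h'.exists_repelling
  obtain ⟨x, hx, hx'⟩ : ∃ x : limitSet Γ, (x : Sphere) ≠ p ∧ (f x : Sphere) ≠ p' := by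
    -- of three limit points, at most one is `p` and at most one has image `p'`
    obtain ⟨x, hx⟩ := h3
    by_contra! hcon
    have i1 : ∀ i j, (x i : Sphere) = p → (x j : Sphere) = p → i = j := fun i j hi hj =>
      hx (Subtype.ext (hi.trans hj.symm))
    have i2 : ∀ i j, (f (x i) : Sphere) = p' → (f (x j) : Sphere) = p' → i = j := fun i j hi hj =>
      hx (f.injective (Subtype.ext (hi.trans hj.symm)))
    have c := fun i => hcon (x i)
    have n01 : (0 : Fin 3) ≠ 1 := by decide
    have n02 : (0 : Fin 3) ≠ 2 := by decide
    have n12 : (1 : Fin 3) ≠ 2 := by decide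
    by_cases a0 : (x 0 : Sphere) = p
    · have b1 := c 1 fun a1 => n01 (i1 _ _ a0 a1)
      have b2 := c 2 fun a2 => n02 (i1 _ _ a0 a2)
      exact n12 (i2 _ _ b1 b2)
    · have b0 := c 0 a0
      by_cases a1 : (x 1 : Sphere) = p
      · exact n02 (i2 _ _ b0 (c 2 fun a2 => n12 (i1 _ _ a1 a2)))
      · exact n01 (i2 _ _ b0 (c 1 a1))
  have hy : ∀ n, (γ n : PSL2C) • (x : Sphere) ∈ limitSet Γ := fun n =>
    smul_mem_limitSet (γ n).2 x.2
  have t1 : Tendsto (fun n => (⟨_, hy n⟩ : limitSet Γ)) l (𝓝 η) := by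
    rw [tendsto_subtype_rng, hη]
    simpa only [hA] using hp x hx
  have t2 := (continuous_subtype_val.tendsto _).comp ((f.continuous.tendsto η).comp t1)
  have t3 := hp' _ hx'
  refine tendsto_nhds_unique t2 (t3.congr fun n => ?_)
  rw [hB]
  exact (hf (γ n) x ⟨_, hy n⟩ rfl).symm

/-! ### Zariski density and the limit set -/

/-- Complex functions on `∏ᵢ SL₂(ℂ)` whose real and imaginary parts are real polynomials in the
real coordinates. -/
def IsRealPolynomial {d : ℕ} (φ : (Fin d → SL(2, ℂ)) → ℂ) : Prop :=
  ∃ p q : MvPolynomial (Fin d × Fin 2 × Fin 2 × Bool) ℝ, ∀ g,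
    φ g = (MvPolynomial.eval (realCoords g) p : ℂ) + MvPolynomial.eval (realCoords g) q * Complex.I

namespace IsRealPolynomial

variable {d : ℕ} {φ ψ : (Fin d → SL(2, ℂ)) → ℂ}

theorem const (c : ℂ) : IsRealPolynomial fun _ : Fin d → SL(2, ℂ) => c :=
  ⟨MvPolynomial.C c.re, MvPolynomial.C c.im, fun g => by simp⟩

theorem entry (k : Fin d) (i j : Fin 2) :
    IsRealPolynomial fun g : Fin d → SL(2, ℂ) => (g k).1 i j :=
  ⟨MvPolynomial.X (k, i, j, false), MvPolynomial.X (k, i, j, true), fun g => by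
    simp [realCoords]⟩

theorem add (h : IsRealPolynomial φ) (h' : IsRealPolynomial ψ) :
    IsRealPolynomial fun g => φ g + ψ g := by
  obtain ⟨p, q, h⟩ := h
  obtain ⟨p', q', h'⟩ := h'
  refine ⟨p + p', q + q', fun g => ?_⟩
  simp only [h, h', map_add]
  push_cast
  ring

theorem mul (h : IsRealPolynomial φ) (h' : IsRealPolynomial ψ) :
    IsRealPolynomial fun g => φ g * ψ g := by
  obtain ⟨p, q, h⟩ := h
  obtain ⟨p', q', h'⟩ := h'
  refine ⟨p * p' - q * q', p * q' + q * p', fun g => ?_⟩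
  simp only [h, h', map_add, map_sub, map_mul]
  push_cast
  linear_combination (MvPolynomial.eval (realCoords g) q : ℂ) *
    MvPolynomial.eval (realCoords g) q' * Complex.I_sq

theorem wedge_mulVec (k : Fin d) (x v : Fin 2 → ℂ) :
    IsRealPolynomial fun g : Fin d → SL(2, ℂ) => wedge ((g k).1 *ᵥ x) v := by
  have e : (fun g : Fin d → SL(2, ℂ) => wedge ((g k).1 *ᵥ x) v) = fun g =>
      ((g k).1 0 0 * x 0 + (g k).1 0 1 * x 1) * v 1 +
        ((g k).1 1 0 * x 0 + (g k).1 1 1 * x 1) * (-v 0) := by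
    funext g
    rw [wedge, mulVec_zero_apply, mulVec_one_apply]
    ring
  rw [e]
  have t := fun i j => (entry k i j).mul (const (d := d) (x j))
  exact (((t 0 0).add (t 0 1)).mul (const (v 1))).add (((t 1 0).add (t 1 1)).mul (const (-v 0)))

theorem eq_zero (h : IsRealPolynomial φ) {S : Set (G d)} (hS : IsZariskiDense S)
    (h0 : ∀ g : Fin d → SL(2, ℂ), (fun i => (g i : PSL2C)) ∈ S → φ g = 0)
    (g : Fin d → SL(2, ℂ)) : φ g = 0 := by
  obtain ⟨p, q, h⟩ := h
  have hp := hS p fun g hg => by simpa [h g] using congrArg Complex.re (h0 g hg)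
  have hq := hS q fun g hg => by simpa [h g] using congrArg Complex.im (h0 g hg)
  rw [h, hp g, hq g]
  simp

end IsRealPolynomial

theorem exists_sl_column {x : Fin 2 → ℂ} (hx : x ≠ 0) :
    ∃ A : SL(2, ℂ), A.1 *ᵥ ![1, 0] = x := by
  by_cases h : x 0 = 0
  · have h1 : x 1 ≠ 0 := by rw [vec_ne_zero_iff] at hx; tauto
    refine ⟨⟨!![0, -(x 1)⁻¹; x 1, 0], by rw [det_fin_two_of]; field_simp; simp⟩, ?_⟩
    ext i
    fin_cases i <;> simp [mulVec, dotProduct, Fin.sum_univ_two, h]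
  · refine ⟨⟨!![x 0, 0; x 1, (x 0)⁻¹], by rw [det_fin_two_of]; field_simp; simp⟩, ?_⟩
    ext i
    fin_cases i <;> simp [mulVec, dotProduct, Fin.sum_univ_two]

theorem exists_wedge_ne_zero {u v : Fin 2 → ℂ} (hu : u ≠ 0) (hv : v ≠ 0) :
    ∃ y : Fin 2 → ℂ, y ≠ 0 ∧ wedge y u ≠ 0 ∧ wedge y v ≠ 0 := by
  rw [vec_ne_zero_iff] at hu hv
  simp only [wedge]
  by_cases h1 : u 1 ≠ 0 ∧ v 1 ≠ 0
  · exact ⟨![1, 0], by simp, by simpa using h1.1, by simpa using h1.2⟩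
  by_cases h0 : u 0 ≠ 0 ∧ v 0 ≠ 0
  · exact ⟨![0, 1], by simp, by simpa using h0.1, by simpa using h0.2⟩
  refine ⟨![1, 1], by simp, ?_, ?_⟩ <;>
    simp only [cons_val_zero, cons_val_one, one_mul, sub_ne_zero] <;> intro h <;> grind

/-- If the self-joining is Zariski dense, a non-empty limit set is not contained in a pair of
points: otherwise the polynomial condition `g ξ ∈ {p, q}` for a limit point `ξ` would hold for all
`g ∈ SL₂(ℂ)`. -/
theorem exists_mem_limitSet_ne {d : ℕ} [NeZero d] {Γ : Subgroup PSL2C} {ρ : Fin d → Γ →* PSL2C}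
    (hρ_id : ρ 0 = Γ.subtype) (hZ : IsZariskiDense (selfJoining ρ : Set (G d)))
    (hne : (limitSet Γ).Nonempty) (p q : Sphere) : ∃ x ∈ limitSet Γ, x ≠ p ∧ x ≠ q := by
  by_contra! hcon
  obtain ⟨ξ, hξ⟩ := hne
  obtain ⟨x, hx, rfl⟩ := exists_toSphere_eq ξ
  obtain ⟨u, hu, rfl⟩ := exists_toSphere_eq p
  obtain ⟨v, hv, rfl⟩ := exists_toSphere_eq q
  have hpoly := (IsRealPolynomial.wedge_mulVec (d := d) 0 x u).mul
    (IsRealPolynomial.wedge_mulVec 0 x v)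
  have hzero := hpoly.eq_zero hZ (by
    rintro g ⟨γ, hγ⟩
    have e : ((g 0 : SL(2, ℂ)) : PSL2C) = γ := by
      have := congrFun hγ 0
      simp only [MonoidHom.pi_apply, hρ_id] at this
      exact this.symm
    have hm : toSphere ((g 0).1 *ᵥ x) ∈ limitSet Γ := by
      rw [← smul_toSphere _ hx, e]
      exact smul_mem_limitSet γ.2 hξ
    have h0 := mulVec_ne_zero (g 0) hx
    by_cases hp : toSphere ((g 0).1 *ᵥ x) = toSphere u
    · rw [(toSphere_eq_iff h0 hu).1 hp, zero_mul]
    · rw [(toSphere_eq_iff h0 hv).1 (hcon _ hm hp), mul_zero])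
  obtain ⟨y, hy, hyu, hyv⟩ := exists_wedge_ne_zero hu hv
  obtain ⟨B, hB⟩ := exists_sl_column hx
  obtain ⟨C, hC⟩ := exists_sl_column hy
  have := hzero fun _ => C * B⁻¹
  rw [Matrix.SpecialLinearGroup.coe_mul, ← mulVec_mulVec, ← hB, inv_mulVec_mulVec, hC] at this
  exact mul_ne_zero hyu hyv this

theorem exists_three_limit_points {d : ℕ} [NeZero d] {Γ : Subgroup PSL2C} {ρ : Fin d → Γ →* PSL2C}
    (hρ_id : ρ 0 = Γ.subtype) (hZ : IsZariskiDense (selfJoining ρ : Set (G d)))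
    (hne : (limitSet Γ).Nonempty) : ∃ x : Fin 3 → limitSet Γ, Function.Injective x := by
  have key := exists_mem_limitSet_ne hρ_id hZ hne
  obtain ⟨x, hx⟩ := hne
  obtain ⟨y, hy, hyx, -⟩ := key x x
  obtain ⟨z, hz, hzx, hzy⟩ := key x y
  refine ⟨![⟨x, hx⟩, ⟨y, hy⟩, ⟨z, hz⟩], ?_⟩
  intro i j hij
  fin_cases i <;> fin_cases j <;> simp_all [Subtype.ext_iff]

/-! ### Geodesics and conical limit points -/

/-- A continuous function is bounded on suitable representatives of the points of a compact subset of
a quotient by a group of homeomorphisms. -/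
theorem exists_bound_of_isCompact_quotient {L X : Type*} [Group L] [TopologicalSpace X]
    [MulAction L X] [ContinuousConstSMul L X] {K : Set (MulAction.orbitRel.Quotient L X)}
    (hK : IsCompact K) {φ : X → ℝ} (hφ : Continuous φ) :
    ∃ R, ∀ x, (Quotient.mk (MulAction.orbitRel L X) x) ∈ K → ∃ g : L, φ (g • x) ≤ R := by
  let U : ℕ → Set (MulAction.orbitRel.Quotient L X) := fun n =>
    Quotient.mk (MulAction.orbitRel L X) '' {x | φ x < n}
  have hU : ∀ n, IsOpen (U n) := fun n =>
    isOpenMap_quotient_mk'_mul _ (isOpen_lt hφ continuous_const)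
  have hmono : Monotone U := fun m n hmn => image_mono fun x (hx : φ x < m) =>
    lt_of_lt_of_le hx (Nat.cast_le.2 hmn)
  have hcov : K ⊆ ⋃ n, U n := by
    intro y _
    obtain ⟨x, rfl⟩ := Quotient.exists_rep y
    obtain ⟨n, hn⟩ := exists_nat_gt (φ x)
    exact mem_iUnion.2 ⟨n, x, hn, rfl⟩
  obtain ⟨n, hn⟩ := hK.elim_directed_cover U hU hcov hmono.directed_le
  refine ⟨n, fun x hx => ?_⟩
  obtain ⟨y, hy, hyx⟩ := hn hx
  obtain ⟨g, hg⟩ := Quotient.exact hyx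
  exact ⟨g, ((congrArg φ hg).trans_lt hy).le⟩

/-- The expression under the root in the hyperbolic distance of `P o` and `Q o` depends only on
`P⁻¹ Q`. -/
theorem normSq_sub_smul_o (P Q : SL(2, ℂ)) :
    Complex.normSq ((P • HypSpace.o).z - (Q • HypSpace.o).z) +
      ((P • HypSpace.o).r - (Q • HypSpace.o).r) ^ 2 =
    (P • HypSpace.o).r * (Q • HypSpace.o).r * (matNormSq (P⁻¹ * Q).1 - 2) := by
  have hP := normSq_num_o P
  have hQ := normSq_num_o Q
  have pP := (normSq_row_pos P).ne'
  have pQ := (normSq_row_pos Q).ne'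
  have hN : matNormSq (P⁻¹ * Q).1 =
      (Complex.normSq (P.1 0 0) + Complex.normSq (P.1 0 1)) * HypSpace.denom Q HypSpace.o +
      (Complex.normSq (Q.1 0 0) + Complex.normSq (Q.1 0 1)) * HypSpace.denom P HypSpace.o -
      2 * (HypSpace.num P HypSpace.o * conj (HypSpace.num Q HypSpace.o)).re := by
    rw [Matrix.SpecialLinearGroup.coe_mul, inv_val, num_o, num_o, denom_o, denom_o]
    simp only [matNormSq, Matrix.mul_apply, Fin.sum_univ_two, Matrix.of_apply, Matrix.cons_val',
      Matrix.cons_val_zero, Matrix.cons_val_one, Matrix.cons_val_fin_one, Complex.normSq_apply,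
      Complex.add_re, Complex.add_im, Complex.mul_re, Complex.mul_im, Complex.neg_re,
      Complex.neg_im, Complex.conj_re, Complex.conj_im]
    ring
  rw [hN, HypSpace.smul_z, HypSpace.smul_z, smul_o_r, smul_o_r]
  rw [← denom_o] at pP pQ
  rw [← denom_o, ← denom_o]
  generalize HypSpace.denom P HypSpace.o = D at *
  generalize HypSpace.denom Q HypSpace.o = D' at *
  generalize HypSpace.num P HypSpace.o = x at *
  generalize HypSpace.num Q HypSpace.o = y at *
  generalize Complex.normSq (P.1 0 0) + Complex.normSq (P.1 0 1) = T at *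
  generalize Complex.normSq (Q.1 0 0) + Complex.normSq (Q.1 0 1) = T' at *
  have hx : x / (D : ℂ) - y / (D' : ℂ) = ((D⁻¹ : ℝ) : ℂ) * x - ((D'⁻¹ : ℝ) : ℂ) * y := by
    push_cast; ring
  have hT : T = (x.re * x.re + x.im * x.im + 1) / D := by
    rw [eq_div_iff pP, ← Complex.normSq_apply, hP, mul_comm]
  have hT' : T' = (y.re * y.re + y.im * y.im + 1) / D' := by
    rw [eq_div_iff pQ, ← Complex.normSq_apply, hQ, mul_comm]
  rw [hx, hT, hT']
  simp only [Complex.normSq_apply, Complex.sub_re, Complex.sub_im, Complex.mul_re, Complex.mul_im,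
    Complex.ofReal_re, Complex.ofReal_im, Complex.conj_re, Complex.conj_im]
  field_simp
  ring

theorem hdist_smul_o (P Q : SL(2, ℂ)) : HypSpace.hdist (P • HypSpace.o) (Q • HypSpace.o) =
    2 * Real.arsinh (√(matNormSq (P⁻¹ * Q).1 - 2) / 2) := by
  have hpos : 0 < (P • HypSpace.o).r * (Q • HypSpace.o).r :=
    mul_pos (P • HypSpace.o).pos (Q • HypSpace.o).pos
  rw [HypSpace.hdist, ← Complex.normSq_eq_norm_sq, normSq_sub_smul_o, Real.sqrt_mul hpos.le,
    mul_comm 2 √_, mul_div_mul_left _ _ (Real.sqrt_pos.2 hpos).ne']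

theorem diag_val (t : ℝ) :
    (diag t).1 = !![(Real.exp (t / 2) : ℂ), 0; 0, (Real.exp (-t / 2) : ℂ)] := rfl

theorem diag_inv_mul_diag (s t : ℝ) : (diag s)⁻¹ * diag t = diag (t - s) := by
  apply Subtype.ext
  rw [Matrix.SpecialLinearGroup.coe_mul, inv_val, diag_val, diag_val, diag_val]
  ext i j
  fin_cases i <;> fin_cases j <;>
    simp [Matrix.mul_apply, Fin.sum_univ_two, ← Complex.exp_add] <;> ring_nf

theorem matNormSq_diag (t : ℝ) : matNormSq (diag t).1 = Real.exp t + Real.exp (-t) := by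
  rw [diag_val]
  simp only [matNormSq, Matrix.of_apply, Matrix.cons_val', Matrix.cons_val_zero,
      Matrix.cons_val_one, Matrix.cons_val_fin_one, Complex.normSq_ofReal, map_zero, add_zero,
      ← Real.exp_add]
  ring_nf

theorem hdist_mul_diag (E : SL(2, ℂ)) (s t : ℝ) :
    HypSpace.hdist ((E * diag s) • HypSpace.o) ((E * diag t) • HypSpace.o) = |s - t| := by
  rw [hdist_smul_o, _root_.mul_inv_rev, mul_assoc, inv_mul_cancel_left, diag_inv_mul_diag, matNormSq_diag]
  have e : Real.exp (t - s) + Real.exp (-(t - s)) - 2 = (2 * Real.sinh ((t - s) / 2)) ^ 2 := by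
    rw [Real.sinh_eq]
    have h1 : Real.exp (t - s) = Real.exp ((t - s) / 2) ^ 2 := by
      rw [← Real.exp_nat_mul]; ring_nf
    have h2 : Real.exp (-(t - s)) = Real.exp (-((t - s) / 2)) ^ 2 := by
      rw [← Real.exp_nat_mul]; ring_nf
    have h3 : Real.exp ((t - s) / 2) * Real.exp (-((t - s) / 2)) = 1 := by
      rw [← Real.exp_add]; simp
    rw [h1, h2]
    linear_combination 2 * h3
  rw [e, Real.sqrt_sq_eq_abs, abs_mul, abs_two, mul_div_cancel_left₀ _ two_ne_zero, Real.abs_sinh,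
    Real.arsinh_sinh, abs_div, abs_two, abs_sub_comm]
  ring

theorem tendsto_matrix {ι : Type*} {l : Filter ι} {M : ι → Matrix (Fin 2) (Fin 2) ℂ}
    {B : Matrix (Fin 2) (Fin 2) ℂ} (h : ∀ i j, Tendsto (fun n => M n i j) l (𝓝 (B i j))) :
    Tendsto M l (𝓝 B) :=
  tendsto_pi_nhds.2 fun i => tendsto_pi_nhds.2 fun j => h i j

theorem tendsto_ofReal_exp_neg :
    Tendsto (fun t : ℝ => ((Real.exp (-t) : ℝ) : ℂ)) atTop (𝓝 0) := by
  have := (Complex.continuous_ofReal.tendsto 0).comp Real.tendsto_exp_neg_atTop_nhds_zero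
  rwa [Complex.ofReal_zero] at this

theorem attracts_diag_atTop : Attracts atTop diag ![1, 0] ![1, 0] := by
  refine ⟨by simp, by simp, fun t => Real.exp (-t / 2), fun t => Real.exp_pos _, ?_,
    tendsto_matrix ?_⟩
  · exact Real.tendsto_exp_atBot.comp (tendsto_neg_atTop_atBot.atBot_div_const two_pos)
  · have e1 : ∀ t : ℝ, Real.exp (-t / 2) * Real.exp (t / 2) = 1 := fun t => by
      rw [← Real.exp_add]; ring_nf; simp
    have e2 : ∀ t : ℝ, Real.exp (-t / 2) * Real.exp (-t / 2) = Real.exp (-t) := fun t => by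
      rw [← Real.exp_add]; ring_nf
    intro i j
    fin_cases i <;> fin_cases j <;>
      simp only [diag_val, vecMulVec_apply, Matrix.smul_apply, smul_eq_mul, ← Complex.ofReal_mul,
        e1, e2, Fin.zero_eta, Fin.mk_one, Matrix.of_apply, Matrix.cons_val', Matrix.cons_val_zero,
        Matrix.cons_val_one, Matrix.cons_val_fin_one, mul_zero, mul_one, Complex.ofReal_one]
    · exact tendsto_const_nhds
    · exact tendsto_const_nhds
    · exact tendsto_const_nhds
    · exact tendsto_ofReal_exp_neg

theorem attracts_diag_atBot : Attracts atBot diag ![0, 1] ![0, 1] := by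
  refine ⟨by simp, by simp, fun t => Real.exp (t / 2), fun t => Real.exp_pos _, ?_,
    tendsto_matrix ?_⟩
  · exact Real.tendsto_exp_atBot.comp (tendsto_id.atBot_div_const two_pos)
  · have e1 : ∀ t : ℝ, Real.exp (t / 2) * Real.exp (-t / 2) = 1 := fun t => by
      rw [← Real.exp_add]; ring_nf; simp
    have e2 : ∀ t : ℝ, Real.exp (t / 2) * Real.exp (t / 2) = Real.exp (- -t) := fun t => by
      rw [← Real.exp_add]; ring_nf
    intro i j
    fin_cases i <;> fin_cases j <;>
      simp only [diag_val, vecMulVec_apply, Matrix.smul_apply, smul_eq_mul, ← Complex.ofReal_mul,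
        e1, e2, Fin.zero_eta, Fin.mk_one, Matrix.of_apply, Matrix.cons_val', Matrix.cons_val_zero,
        Matrix.cons_val_one, Matrix.cons_val_fin_one, mul_zero, mul_one, Complex.ofReal_one]
    · exact tendsto_ofReal_exp_neg.comp tendsto_neg_atBot_atTop
    · exact tendsto_const_nhds
    · exact tendsto_const_nhds
    · exact tendsto_const_nhds

/-- The translates of the vertical geodesic `t ↦ (0, eᵗ)` are geodesic lines. -/
theorem isGeodesicLine_mul_diag (E : SL(2, ℂ)) :
    IsGeodesicLine (fun t => (E * diag t) • HypSpace.o) (toSphere (E.1 *ᵥ ![0, 1]))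
      (toSphere (E.1 *ᵥ ![1, 0])) :=
  ⟨hdist_mul_diag E, (attracts_diag_atBot.smul_left E).tendsToBoundary,
    (attracts_diag_atTop.smul_left E).tendsToBoundary⟩

theorem exists_sl_frame {x y : Fin 2 → ℂ} (h : wedge x y ≠ 0) :
    ∃ E : SL(2, ℂ), E.1 *ᵥ ![1, 0] = x ∧ E.1 *ᵥ ![0, 1] = (wedge x y)⁻¹ • y := by
  refine ⟨⟨!![x 0, (wedge x y)⁻¹ * y 0; x 1, (wedge x y)⁻¹ * y 1], ?_⟩, ?_, ?_⟩
  · rw [det_fin_two_of]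
    have : x 0 * ((wedge x y)⁻¹ * y 1) - (wedge x y)⁻¹ * y 0 * x 1 =
      (wedge x y)⁻¹ * wedge x y := by rw [wedge]; ring
    rw [this, inv_mul_cancel₀ h]
  · ext i
    fin_cases i <;> simp [mulVec, dotProduct, Fin.sum_univ_two]
  · ext i
    fin_cases i <;> simp [mulVec, dotProduct, Fin.sum_univ_two]

/-- Attraction persists under bounded perturbation on the left and translation on the right. -/
theorem Attracts.mul_mul {ι : Type*} {l : Filter ι} {A B : ι → SL(2, ℂ)} {u w : Fin 2 → ℂ}
    (h : Attracts l A u w) {B₀ : SL(2, ℂ)} (hB : Tendsto B l (𝓝 B₀)) (E : SL(2, ℂ)) :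
    Attracts l (fun n => B n * A n * E) (B₀.1 *ᵥ u) (w ᵥ* E.1) := by
  obtain ⟨hu, hw, s, hs, hs0, hA⟩ := h
  refine ⟨mulVec_ne_zero B₀ hu, ?_, s, hs, hs0, ?_⟩
  · intro h0
    apply hw
    have := congrArg (fun v => v ᵥ* (E⁻¹).1) h0
    simp only [vecMul_vecMul, ← Matrix.SpecialLinearGroup.coe_mul, mul_inv_cancel,
      Matrix.SpecialLinearGroup.coe_one, vecMul_one, zero_vecMul] at this
    exact this
  · have hB' : Tendsto (fun n => (B n).1) l (𝓝 B₀.1) :=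
      (continuous_subtype_val.tendsto _).comp hB
    have hc : Continuous fun p : Matrix (Fin 2) (Fin 2) ℂ × Matrix (Fin 2) (Fin 2) ℂ =>
        p.1 * p.2 * E.1 := (continuous_fst.matrix_mul continuous_snd).matrix_mul continuous_const
    have := (hc.tendsto (B₀.1, vecMulVec u w)).comp (hB'.prodMk_nhds hA)
    simp only [mul_vecMulVec, vecMulVec_mul] at this
    refine this.congr fun n => ?_
    simp only [Function.comp, Matrix.SpecialLinearGroup.coe_mul, Matrix.mul_smul, Matrix.smul_mul]

/-- The limit points of a convex cocompact group are conical: there is a sequence in `Γ` with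
attracting point `u` that keeps the images of `ξ` away from `u`. It brings back to a compact set the
points of a geodesic line in the hull that ends in `ξ`. -/
theorem IsConvexCocompact.exists_conical {Γ : Subgroup PSL2C} (hΓ : IsConvexCocompact Γ)
    {ξ η : Sphere} (hξ : ξ ∈ limitSet Γ) (hη : η ∈ limitSet Γ) (hne : ξ ≠ η) :
    ∃ (γ : ℕ → Γ) (A : ℕ → SL(2, ℂ)) (u w : Fin 2 → ℂ), (∀ n, (A n : PSL2C) = γ n) ∧
      Attracts (hyperfilter ℕ : Filter ℕ) A u w ∧
      ¬ Tendsto (fun n => (A n : PSL2C) • ξ) (hyperfilter ℕ : Filter ℕ) (𝓝 (toSphere u)) := by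
  obtain ⟨x, hx, rfl⟩ := exists_toSphere_eq ξ
  obtain ⟨y, hy, rfl⟩ := exists_toSphere_eq η
  have hxy : wedge x y ≠ 0 := fun h => hne ((toSphere_eq_iff hx hy).2 h)
  obtain ⟨E, hE1, hE2⟩ := exists_sl_frame hxy
  have hgeo := isGeodesicLine_mul_diag E
  rw [hE1, hE2, toSphere_smul (inv_ne_zero hxy)] at hgeo
  -- only the geodesic lines in the hull are needed, not its convexity
  have hhull : ∀ t : ℝ, (E * diag t) • HypSpace.o ∈ hypHull (limitSet Γ) := fun t =>
    mem_sInter.2 fun C hC => hC.2.2 _ hη _ hξ _ hgeo (mem_range_self t)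
  obtain ⟨R, hR⟩ := exists_bound_of_isCompact_quotient hΓ.2 continuous_twoCosh
  choose γ hγ using fun n : ℕ => hR _ (mem_image_of_mem _ (hhull n))
  choose A hA using fun n => QuotientGroup.mk_surjective (γ n : PSL2C)
  have hbd : ∀ n, matNormSq (A n * (E * diag n)).1 ≤ R := by
    intro n
    rw [← sizeSq_coe, sizeSq]
    refine le_trans (le_of_eq ?_) (hγ n)
    rw [QuotientGroup.mk_mul, mul_smul]
    refine congrArg twoCosh ?_
    rw [coe_smul_hyp (E * diag n)]
    exact congrArg (· • _) (hA n)
  obtain ⟨L, hL⟩ := exists_tendsto_of_matNormSq_le (hyperfilter ℕ) (Eventually.of_forall hbd)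
  have hle : (hyperfilter ℕ : Filter ℕ) ≤ atTop := by
    rw [← Nat.cofinite_eq_atTop]; exact hyperfilter_le_cofinite
  have hbot : Tendsto (fun n : ℕ => -(n : ℝ)) (hyperfilter ℕ : Filter ℕ) atBot :=
    tendsto_neg_atTop_atBot.comp (tendsto_natCast_atTop_atTop.mono_left hle)
  have hatt := (attracts_diag_atBot.comp hbot).mul_mul hL E⁻¹
  have hinv : ∀ t : ℝ, diag t * diag (-t) = 1 := by
    intro t
    have h1 := diag_inv_mul_diag (-t) (-t)
    have h2 := diag_inv_mul_diag (-t) 0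
    have h3 : diag 0 = 1 := by rw [← sub_self (-t), ← h1, inv_mul_cancel]
    rw [h3, mul_one, zero_sub, neg_neg] at h2
    rw [← h2, inv_mul_cancel]
  have hAeq : (fun n : ℕ => A n * (E * diag n) * (diag ∘ fun n : ℕ => -(n : ℝ)) n * E⁻¹) = A := by
    funext n
    simp only [Function.comp]
    rw [mul_assoc (A n), mul_assoc E, hinv, mul_one, mul_inv_cancel_right]
  -- `A n = L n diag(-n) E⁻¹` with `L n` convergent, so `A n` attracts to `L e₂` while `A n ξ → L e₁`
  rw [hAeq] at hatt
  refine ⟨γ, A, _, _, hA, hatt, fun hcon => ?_⟩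
  have e1 : (![1, 0] : Fin 2 → ℂ) ≠ 0 := by simp
  have e2 : (![0, 1] : Fin 2 → ℂ) ≠ 0 := by simp
  have hlim : Tendsto (fun n => (A n : PSL2C) • toSphere x) (hyperfilter ℕ : Filter ℕ)
      (𝓝 (toSphere (L.1 *ᵥ ![1, 0]))) := by
    have hc : Continuous fun B : SL(2, ℂ) => B.1 *ᵥ (![1, 0] : Fin 2 → ℂ) :=
      continuous_subtype_val.matrix_mulVec continuous_const
    refine ((continuousAt_toSphere (mulVec_ne_zero L e1)).tendsto.comp
      ((hc.tendsto L).comp hL)).congr fun n => ?_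
    have hexp : (Real.exp ((n : ℝ) / 2) : ℂ) ≠ 0 := Complex.ofReal_ne_zero.2 (Real.exp_pos _).ne'
    have hd : (diag (n : ℝ)).1 *ᵥ ![1, 0] = (Real.exp ((n : ℝ) / 2) : ℂ) • ![1, 0] := by
      rw [diag_val]
      ext i
      fin_cases i <;> simp [mulVec, dotProduct, Fin.sum_univ_two]
    simp only [Function.comp]
    rw [smul_toSphere _ hx, Matrix.SpecialLinearGroup.coe_mul, Matrix.SpecialLinearGroup.coe_mul,
      ← mulVec_mulVec, ← mulVec_mulVec, hd, mulVec_smul, mulVec_smul, hE1, toSphere_smul hexp]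
  have := tendsto_nhds_unique hlim hcon
  rw [toSphere_eq_iff (mulVec_ne_zero L e1) (mulVec_ne_zero L e2), wedge_mulVec] at this
  simp [wedge] at this

/-! ### Circles as translates of the unit circle -/

theorem mem_smul_unitCircle (A : SL(2, ℂ)) {v : Fin 2 → ℂ} (hv : v ≠ 0) :
    toSphere v ∈ (A : PSL2C) • unitCircle ↔
      Complex.normSq (A.1 1 1 * v 0 - A.1 0 1 * v 1) =
        Complex.normSq (A.1 0 0 * v 1 - A.1 1 0 * v 0) := by
  have e : ((A : PSL2C))⁻¹ • toSphere v = toSphere ((A⁻¹).1 *ᵥ v) := smul_toSphere A⁻¹ hv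
  rw [Set.mem_smul_set_iff_inv_smul_mem, e, toSphere_mem_unitCircle (mulVec_ne_zero A⁻¹ hv),
    mulVec_zero_apply, mulVec_one_apply, inv_val]
  simp only [Matrix.of_apply, Matrix.cons_val', Matrix.cons_val_zero, Matrix.cons_val_one,
    Matrix.cons_val_fin_one]
  ring_nf

/-- Möbius transformations map the unit circle to circles: the image is the zero set of a Hermitian
form of determinant `-1`. -/
theorem isCircle_smul_unitCircle (A : SL(2, ℂ)) : IsCircle ((A : PSL2C) • unitCircle) := by
  have hcoe : ∀ z : ℂ, (z : Sphere) ∈ (A : PSL2C) • unitCircle ↔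
      Complex.normSq (A.1 1 1 * z - A.1 0 1) = Complex.normSq (A.1 0 0 - A.1 1 0 * z) := by
    intro z
    have h := mem_smul_unitCircle A (v := ![z, 1]) (by simp)
    simpa [toSphere] using h
  have hinf : (OnePoint.infty : Sphere) ∈ (A : PSL2C) • unitCircle ↔
      Complex.normSq (A.1 1 1) = Complex.normSq (A.1 1 0) := by
    have h := mem_smul_unitCircle A (v := ![1, 0]) (by simp)
    simpa [toSphere] using h
  have hd := sl_det_eq A
  generalize (A : PSL2C) • unitCircle = C at *
  generalize A.1 0 0 = a at *
  generalize A.1 0 1 = b at *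
  generalize A.1 1 0 = c at *
  generalize A.1 1 1 = d at *
  set α : ℝ := Complex.normSq d - Complex.normSq c with hα
  set β : ℂ := d * conj b - c * conj a with hβ
  set γ : ℝ := Complex.normSq b - Complex.normSq a with hγ
  have hdet : Complex.normSq β - α * γ = 1 := by
    have h1 : Complex.normSq β - α * γ = Complex.normSq (a * d - b * c) := by
      rw [hα, hβ, hγ]
      simp only [Complex.normSq_apply, Complex.sub_re, Complex.sub_im, Complex.mul_re,
        Complex.mul_im, Complex.conj_re, Complex.conj_im]
      ring
    rw [h1, hd, map_one]
  have hform : ∀ z : ℂ, (z : Sphere) ∈ C ↔ α * Complex.normSq z - 2 * (β * z).re + γ = 0 := by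
    intro z
    rw [hcoe, ← sub_eq_zero, hα, hβ, hγ]
    simp only [Complex.normSq_apply, Complex.sub_re, Complex.sub_im, Complex.mul_re,
      Complex.mul_im, Complex.conj_re, Complex.conj_im]
    ring_nf
  by_cases h0 : α = 0
  · right
    have hb1 : Complex.normSq β = 1 := by rw [h0] at hdet; linarith
    have hbc : β * conj β = 1 := by rw [Complex.mul_conj, hb1, Complex.ofReal_one]
    have hb0 : conj β ≠ 0 := right_ne_zero_of_mul_eq_one hbc
    refine ⟨(γ / 2 : ℝ) * conj β, Complex.I * conj β, mul_ne_zero Complex.I_ne_zero hb0, ?_⟩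
    ext ξ
    induction ξ using OnePoint.rec with
    | infty =>
      simp only [mem_insert_iff, true_or, iff_true]
      rw [hinf]; linarith
    | coe z =>
      rw [hform, h0]
      simp only [mem_insert_iff, OnePoint.coe_ne_infty, false_or, mem_image, mem_range,
        exists_exists_eq_and, OnePoint.coe_eq_coe]
      constructor
      · intro h
        refine ⟨(β * z).im, ?_⟩
        have hre : (β * z).re = γ / 2 := by linarith
        calc ((γ / 2 : ℝ) : ℂ) * conj β + ((β * z).im : ℂ) * (Complex.I * conj β)
            = conj β * (((β * z).re : ℂ) + (β * z).im * Complex.I) := by rw [hre]; ring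
          _ = z := by rw [Complex.re_add_im]; linear_combination z * hbc
      · rintro ⟨t, rfl⟩
        have : β * (((γ / 2 : ℝ) : ℂ) * conj β + t * (Complex.I * conj β)) =
            ((γ / 2 : ℝ) : ℂ) + t * Complex.I := by
          linear_combination (((γ / 2 : ℝ) : ℂ) + t * Complex.I) * hbc
        rw [this]
        simp
        ring
  · left
    refine ⟨conj β / α, |α|⁻¹, inv_pos.2 (abs_pos.2 h0), ?_⟩
    ext ξ
    induction ξ using OnePoint.rec with
    | infty =>
      rw [hinf]
      simp only [mem_image, OnePoint.coe_ne_infty, and_false, exists_false, iff_false]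
      intro h
      exact h0 (by rw [hα, h, sub_self])
    | coe z =>
      rw [hform]
      simp only [mem_image, OnePoint.coe_eq_coe, exists_eq_right, mem_sphere_iff_norm]
      rw [← sq_eq_sq₀ (norm_nonneg _) (inv_nonneg.2 (abs_nonneg _)), ← Complex.normSq_eq_norm_sq,
        inv_pow, sq_abs]
      have e : conj β / (α : ℂ) = ((α⁻¹ : ℝ) : ℂ) * conj β := by push_cast; ring
      have e2 : Complex.normSq (z - conj β / (α : ℂ)) - (α ^ 2)⁻¹ =
          α⁻¹ * (α * Complex.normSq z - 2 * (β * z).re + γ) := by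
        have hg : Complex.normSq β = 1 + α * γ := by linarith
        rw [e]
        simp only [Complex.normSq_apply, Complex.sub_re, Complex.sub_im, Complex.mul_re,
          Complex.mul_im, Complex.conj_re, Complex.conj_im, Complex.ofReal_re,
          Complex.ofReal_im] at hg ⊢
        field_simp
        linear_combination hg
      rw [← sub_eq_zero (b := (α ^ 2)⁻¹), e2, mul_eq_zero, or_iff_right (inv_ne_zero h0)]

theorem smul_unitCircle_eq_image (A : SL(2, ℂ)) : (A : PSL2C) • unitCircle =
    (fun z : ℂ => toSphere (A.1 *ᵥ ![z, 1])) '' Metric.sphere 0 1 := by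
  have e : ∀ z : ℂ, (A : PSL2C) • (z : Sphere) = toSphere (A.1 *ᵥ ![z, 1]) := by
    intro z
    rw [← smul_toSphere A (by simp)]
    simp [toSphere]
  ext ξ
  constructor
  · rintro ⟨_, ⟨z, hz, rfl⟩, rfl⟩
    exact ⟨z, hz, (e z).symm⟩
  · rintro ⟨z, hz, rfl⟩
    exact ⟨z, ⟨z, hz, rfl⟩, e z⟩

/-- The circle `A C₀` depends continuously on `A`. -/
theorem setTendsto_smul_unitCircle {A : ℕ → SL(2, ℂ)} {B : SL(2, ℂ)}
    (h : Tendsto A atTop (𝓝 B)) :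
    SetTendsto (fun n => (A n : PSL2C) • unitCircle) ((B : PSL2C) • unitCircle) := by
  have hc : ∀ p : SL(2, ℂ) × ℂ,
      ContinuousAt (fun p : SL(2, ℂ) × ℂ => toSphere (p.1.1 *ᵥ ![p.2, 1])) p := by
    intro p
    have h1 : Continuous fun p : SL(2, ℂ) × ℂ => p.1.1 *ᵥ (![p.2, 1] : Fin 2 → ℂ) := by
      refine (continuous_subtype_val.comp continuous_fst).matrix_mulVec ?_
      refine continuous_pi fun i => ?_
      fin_cases i
      · exact continuous_snd
      · exact continuous_const
    exact ContinuousAt.comp (f := fun p : SL(2, ℂ) × ℂ => p.1.1 *ᵥ (![p.2, 1] : Fin 2 → ℂ))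
      (continuousAt_toSphere (mulVec_ne_zero p.1 (by simp))) h1.continuousAt
  unfold SetTendsto
  rw [TopologicalSpace.vietoris, TopologicalSpace.tendsto_nhds_generateFrom_iff]
  rintro _ (⟨U, hU, rfl⟩ | ⟨U, hU, rfl⟩) hB
  · have hB' : ∀ z ∈ Metric.sphere (0 : ℂ) 1, toSphere (B.1 *ᵥ ![z, 1]) ∈ U := by
      intro z hz
      apply hB
      rw [smul_unitCircle_eq_image]
      exact mem_image_of_mem _ hz
    have := (isCompact_sphere (0 : ℂ) 1).eventually_forall_of_forall_eventually
      (P := fun A z => toSphere (A.1 *ᵥ ![z, 1]) ∈ U) (x₀ := B) fun z hz =>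
        (hc (B, z)).eventually (IsOpen.mem_nhds hU (hB' z hz))
    filter_upwards [h.eventually this] with n hn
    change (A n : PSL2C) • unitCircle ⊆ U
    rw [smul_unitCircle_eq_image]
    rintro _ ⟨z, hz, rfl⟩
    exact hn z hz
  · obtain ⟨ξ, hξ, hξU⟩ := hB
    rw [smul_unitCircle_eq_image] at hξ
    obtain ⟨z, hz, rfl⟩ := hξ
    have hcz : Tendsto (fun n => toSphere ((A n).1 *ᵥ ![z, 1])) atTop
        (𝓝 (toSphere (B.1 *ᵥ ![z, 1]))) := by
      have h2 : Continuous fun A : SL(2, ℂ) => A.1 *ᵥ (![z, 1] : Fin 2 → ℂ) :=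
        continuous_subtype_val.matrix_mulVec continuous_const
      exact (continuousAt_toSphere (mulVec_ne_zero B (by simp))).tendsto.comp
        ((h2.tendsto B).comp h)
    have hU' : IsOpen U := hU
    have hξU' : toSphere (B.1 *ᵥ ![z, 1]) ∈ U := hξU
    filter_upwards [hcz.eventually_mem (hU'.mem_nhds hξU')] with n hn
    change ((A n : PSL2C) • unitCircle ∩ U).Nonempty
    refine ⟨toSphere ((A n).1 *ᵥ ![z, 1]), ?_, hn⟩
    rw [smul_unitCircle_eq_image]
    exact ⟨z, hz, rfl⟩

instance : FirstCountableTopology SL(2, ℂ) := by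
  have : FirstCountableTopology (Matrix (Fin 2) (Fin 2) ℂ) :=
    inferInstanceAs (FirstCountableTopology (Fin 2 → Fin 2 → ℂ))
  exact (IsInducing.subtypeVal (Y := Matrix (Fin 2) (Fin 2) ℂ)
    (t := fun A => A.det = 1)).firstCountableTopology

theorem smul_unitCircle_mem_torusOrbit {d : ℕ} {Γ : Subgroup PSL2C} (ρ : Fin d → Γ →* PSL2C) (γ : Γ) :
    (fun i => ρ i γ • unitCircle) ∈ torusOrbit ρ (torus₀ d) :=
  ⟨fun i => ρ i γ, ⟨γ, rfl⟩, rfl⟩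

/-- If the packing is locally finite, then only finitely many of its tori have all their circles of
definite size, i.e. translates of the unit circle by a bounded set. -/
theorem finite_tori_of_bounded {d : ℕ} {Γ : Subgroup PSL2C} (ρ : Fin d → Γ →* PSL2C)
    (hP : LocallyFiniteTori (torusOrbit ρ (torus₀ d))) (R : ℝ) :
    {T : Fin d → Set Sphere | ∃ γ : Γ, T = (fun i => ρ i γ • unitCircle) ∧
      ∀ i, ∃ h : PSL2C, h • unitCircle = unitCircle ∧ sizeSq (ρ i γ * h) ≤ R}.Finite := by
  by_contra hinf
  let T := Set.Infinite.natEmbedding _ hinf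
  choose γ hγ h hh hR using fun n => (T n).2
  choose A hA using fun n i => QuotientGroup.mk_surjective (ρ i (γ n) * h n i)
  have hAR : ∀ n, A n ∈ Set.pi univ fun _ : Fin d => {B : SL(2, ℂ) | matNormSq B.1 ≤ R} := by
    intro n i _
    refine le_trans (le_of_eq ?_) (hR n i)
    rw [← sizeSq_coe]
    exact congrArg sizeSq (hA n i)
  obtain ⟨B, -, θ, hθ, hB⟩ :=
    (isCompact_univ_pi fun _ : Fin d => isCompact_sl_matNormSq_le R).tendsto_subseq hAR
  refine hP ⟨fun n => (T (θ n)).1, Subtype.val_injective.comp (T.injective.comp hθ.injective),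
    fun n => ?_, fun i => (B i : PSL2C) • unitCircle, fun i => isCircle_smul_unitCircle _,
    fun i => ?_⟩
  · change (T (θ n)).1 ∈ _
    rw [hγ]
    exact smul_unitCircle_mem_torusOrbit ρ _
  · have := setTendsto_smul_unitCircle ((tendsto_pi_nhds.1 hB) i)
    refine this.congr fun n => ?_
    change _ = (T (θ n)).1 i
    rw [hγ]
    have e : (((A ∘ θ) n i : SL(2, ℂ)) : PSL2C) = ρ i (γ (θ n)) * h (θ n) i := hA (θ n) i
    rw [e, mul_smul, hh]

/-! ### Contraction at a limit point on the torus -/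

/-- Divergence of a family in `Γ` does not depend on the discrete faithful representation in which
it is measured. -/
theorem tendsto_sizeSq_of_injective {Γ : Subgroup PSL2C} (σ τ : Γ →* PSL2C)
    (hτ : Function.Injective τ) (hd : DiscreteTopology τ.range) {ι : Type*} (l : Ultrafilter ι)
    {γ : ι → Γ} (h : Tendsto (fun n => sizeSq (σ (γ n))) l atTop) :
    Tendsto (fun n => sizeSq (τ (γ n))) l atTop := by
  by_contra hcon
  obtain ⟨C, hC⟩ := exists_bound_of_not_tendsto l hcon
  have hfin := finite_sizeSq_le τ.range C
  have hex : ∀ᶠ n in (l : Filter ι), ∃ g ∈ {g : PSL2C | g ∈ τ.range ∧ sizeSq g ≤ C},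
      τ (γ n) = g := by
    filter_upwards [hC] with n hn
    exact ⟨_, ⟨⟨_, rfl⟩, hn⟩, rfl⟩
  obtain ⟨g, -, hg⟩ := (Ultrafilter.eventually_exists_mem_iff hfin).1 hex
  obtain ⟨n₀, hn₀⟩ := hg.exists
  obtain ⟨n, hn, hn'⟩ := (hg.and (h.eventually_gt_atTop (sizeSq (σ (γ n₀))))).exists
  rw [hτ (hn.trans hn₀.symm)] at hn'
  exact lt_irrefl _ hn'

/-- The property of being conical is transported by a boundary map. -/
theorem IsBoundaryMap.not_tendsto {Γ : Subgroup PSL2C} {σ : Γ →* PSL2C}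
    {f : limitSet Γ ≃ₜ limitSet σ.range} (hf : IsBoundaryMap σ f)
    (h3 : ∃ x : Fin 3 → limitSet Γ, Function.Injective x)
    {ι : Type*} {l : Filter ι} [l.NeBot] {γ : ι → Γ} {A B : ι → SL(2, ℂ)}
    (hA : ∀ n, (A n : PSL2C) = γ n) (hB : ∀ n, (B n : PSL2C) = σ (γ n))
    {u w u' w' : Fin 2 → ℂ} (h : Attracts l A u w) (h' : Attracts l B u' w') (ξ : limitSet Γ)
    (hξ : ¬ Tendsto (fun n => (A n : PSL2C) • (ξ : Sphere)) l (𝓝 (toSphere u))) :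
    ¬ Tendsto (fun n => (B n : PSL2C) • (f ξ : Sphere)) l (𝓝 (toSphere u')) := by
  intro hcon
  have hu : toSphere u ∈ limitSet Γ := h.mem_limitSet fun n => by
    have e : (A n : PSL2C) = γ n := hA n
    rw [e]; exact (γ n).2
  have hη := hf.apply_attracting h3 hA hB h h' ⟨_, hu⟩ rfl
  have hy : ∀ n, (γ n : PSL2C) • (ξ : Sphere) ∈ limitSet Γ := fun n =>
    smul_mem_limitSet (γ n).2 ξ.2
  have t1 : Tendsto (fun n => f ⟨_, hy n⟩) l (𝓝 (f ⟨_, hu⟩)) := by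
    rw [tendsto_subtype_rng, hη]
    refine hcon.congr fun n => ?_
    rw [hB]
    exact (hf (γ n) ξ ⟨_, hy n⟩ rfl).symm
  have t2 := (f.symm.continuous.tendsto _).comp t1
  rw [f.symm_apply_apply, tendsto_subtype_rng] at t2
  refine hξ (t2.congr fun n => ?_)
  simp only [Function.comp, f.symm_apply_apply, hA]

/-- The positive multiple of `v` that is a unit vector, for `v ≠ 0`. -/
def unitVec (v : Fin 2 → ℂ) : Fin 2 → ℂ := (((√(vecNormSq v))⁻¹ : ℝ) : ℂ) • v

theorem vecNormSq_unitVec {v : Fin 2 → ℂ} (hv : v ≠ 0) : vecNormSq (unitVec v) = 1 := by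
  rw [unitVec, vecNormSq_smul, Complex.normSq_ofReal, ← sq, inv_pow,
    Real.sq_sqrt (vecNormSq_nonneg v), inv_mul_cancel₀ (vecNormSq_pos hv).ne']

theorem toSphere_unitVec {v : Fin 2 → ℂ} (hv : v ≠ 0) : toSphere (unitVec v) = toSphere v :=
  toSphere_smul (Complex.ofReal_ne_zero.2 (inv_ne_zero (Real.sqrt_pos.2 (vecNormSq_pos hv)).ne')) v

theorem normSq_wedge_unitVec (u v : Fin 2 → ℂ) : Complex.normSq (wedge (unitVec u) (unitVec v)) =
    (vecNormSq u * vecNormSq v)⁻¹ * Complex.normSq (wedge u v) := by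
  rw [unitVec, unitVec, wedge_smul_smul, Complex.normSq_mul, Complex.normSq_mul,
    Complex.normSq_ofReal, Complex.normSq_ofReal, ← sq, ← sq, inv_pow, inv_pow,
    Real.sq_sqrt (vecNormSq_nonneg u), Real.sq_sqrt (vecNormSq_nonneg v), mul_inv]

theorem exists_tendsto_unitVec {ι : Type*} (l : Ultrafilter ι) {v : ι → Fin 2 → ℂ}
    (hv : ∀ n, v n ≠ 0) : ∃ p : Fin 2 → ℂ, p ≠ 0 ∧ Tendsto (fun n => unitVec (v n)) l (𝓝 p) ∧
      Tendsto (fun n => toSphere (v n)) l (𝓝 (toSphere p)) := by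
  obtain ⟨p, -, hp⟩ := (isCompact_vecNormSq_le 1).ultrafilter_le_nhds
    (l.map fun n => unitVec (v n)) (by
      rw [le_principal_iff]
      exact Eventually.of_forall (f := (l : Filter ι)) fun n => (vecNormSq_unitVec (hv n)).le)
  have hp' : Tendsto (fun n => unitVec (v n)) l (𝓝 p) := hp
  have h1 : vecNormSq p = 1 := by
    refine tendsto_nhds_unique ((continuous_vecNormSq.tendsto p).comp hp') ?_
    exact tendsto_const_nhds.congr fun n => (vecNormSq_unitVec (hv n)).symm
  have h0 : p ≠ 0 := by rintro rfl; simp [vecNormSq] at h1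
  exact ⟨p, h0, hp', ((continuousAt_toSphere h0).tendsto.comp hp').congr fun n =>
    toSphere_unitVec (hv n)⟩

theorem continuous_wedge :
    Continuous fun p : (Fin 2 → ℂ) × (Fin 2 → ℂ) => wedge p.1 p.2 := by
  have h1 := fun i : Fin 2 =>
    (continuous_apply i).comp (continuous_fst (X := Fin 2 → ℂ) (Y := Fin 2 → ℂ))
  have h2 := fun i : Fin 2 =>
    (continuous_apply i).comp (continuous_snd (X := Fin 2 → ℂ) (Y := Fin 2 → ℂ))
  exact ((h1 0).mul (h2 1)).sub ((h1 1).mul (h2 0))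

/-- If the images of the point `v` stay away from the attracting point, then the angle
between `B n v` and `B n v'` stays bounded below, so the product of their norms is bounded because
`B n` preserves the determinant. -/
theorem Attracts.exists_bound_mul {ι : Type*} {l : Ultrafilter ι} {B : ι → SL(2, ℂ)}
    {u w v v' : Fin 2 → ℂ} (h : Attracts l B u w) (hv' : w ⬝ᵥ v' ≠ 0) (hvv' : wedge v v' ≠ 0)
    (hcon : ¬ Tendsto (fun n => (B n : PSL2C) • toSphere v) l (𝓝 (toSphere u))) :
    ∃ C, ∀ᶠ n in (l : Filter ι),
      vecNormSq ((B n).1 *ᵥ v) * vecNormSq ((B n).1 *ᵥ v') ≤ C := by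
  have h0 : v ≠ 0 := by rintro rfl; simp [wedge] at hvv'
  have h0' : v' ≠ 0 := by rintro rfl; simp [wedge] at hvv'
  apply exists_bound_of_not_tendsto
  intro ht
  apply hcon
  obtain ⟨p, hp0, hp, hps⟩ := exists_tendsto_unitVec l fun n => mulVec_ne_zero (B n) h0
  obtain ⟨q, hq0, hq, hqs⟩ := exists_tendsto_unitVec l fun n => mulVec_ne_zero (B n) h0'
  -- if the product is unbounded, the limits `p`, `q` of the two directions coincide
  have hpq : Complex.normSq (wedge p q) = 0 := by
    refine tendsto_nhds_unique (((Complex.continuous_normSq.comp continuous_wedge).tendsto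
      (p, q)).comp (hp.prodMk_nhds hq)) ?_
    have := ht.inv_tendsto_atTop.mul_const (Complex.normSq (wedge v v'))
    rw [zero_mul] at this
    refine this.congr fun n => ?_
    simp only [Function.comp, normSq_wedge_unitVec, wedge_mulVec, Pi.inv_apply]
  have e1 : toSphere p = toSphere q :=
    (toSphere_eq_iff hp0 hq0).2 (Complex.normSq_eq_zero.1 hpq)
  have e2 : toSphere q = toSphere u :=
    tendsto_nhds_unique hqs (h.tendsto_toSphere tendsto_const_nhds hv')
  rw [← e2, ← e1]
  simpa only [smul_toSphere _ h0] using hps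

theorem Attracts.tendsto_vecNormSq {ι : Type*} {l : Filter ι} {B : ι → SL(2, ℂ)}
    {u w v : Fin 2 → ℂ} (h : Attracts l B u w) (hv : w ⬝ᵥ v ≠ 0) :
    Tendsto (fun n => vecNormSq ((B n).1 *ᵥ v)) l atTop := by
  obtain ⟨hu, -, s, hs, hs0, hB⟩ := h
  have h1 := (continuous_vecNormSq.tendsto _).comp
    (tendsto_smul_mulVec hB (tendsto_const_nhds (x := v)))
  rw [vecMulVec_mulVec_eq, vecNormSq_smul] at h1
  have h2 : Tendsto (fun n => (s n ^ 2)⁻¹) l atTop := by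
    apply Tendsto.inv_tendsto_nhdsGT_zero
    rw [tendsto_nhdsWithin_iff]
    exact ⟨by simpa using hs0.pow 2, Eventually.of_forall fun n => pow_pos (hs n) 2⟩
  refine (h2.atTop_mul_pos (mul_pos (Complex.normSq_pos.2 hv) (vecNormSq_pos hu)) h1).congr
    fun n => ?_
  simp only [Function.comp, vecNormSq_smul, Complex.normSq_ofReal]
  have := (hs n).ne'
  field_simp

theorem dotProduct_ne_zero_of_wedge_ne_zero {w v v' : Fin 2 → ℂ} (hw : w ≠ 0) (h : w ⬝ᵥ v = 0)
    (hvv' : wedge v v' ≠ 0) : w ⬝ᵥ v' ≠ 0 := by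
  intro h'
  rw [dotProduct, Fin.sum_univ_two] at h h'
  rcases (vec_ne_zero_iff w).1 hw with h0 | h0
  · refine mul_ne_zero h0 hvv' ?_
    rw [wedge]
    linear_combination v' 1 * h - v 1 * h'
  · refine mul_ne_zero h0 hvv' ?_
    rw [wedge]
    linear_combination v 0 * h' - v' 0 * h

/-- The hyperbolic element of the stabilizer of the unit circle with fixed points `±p` and
eigenvalues `s`, `s⁻¹`. -/
def boost (p : ℂ) (hp : Complex.normSq p = 1) (s : ℝ) (hs : s ≠ 0) : SL(2, ℂ) :=
  ⟨!![((s + s⁻¹) / 2 : ℂ), p * ((s - s⁻¹) / 2);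
      conj p * ((s - s⁻¹) / 2), (s + s⁻¹) / 2], by
    have hpp : p * conj p = 1 := by rw [Complex.mul_conj, hp, Complex.ofReal_one]
    have hss : (s : ℂ) * (s : ℂ)⁻¹ = 1 := mul_inv_cancel₀ (Complex.ofReal_ne_zero.2 hs)
    rw [det_fin_two_of, Complex.ofReal_inv]
    linear_combination (-(((s : ℂ) - (s : ℂ)⁻¹) / 2) ^ 2) * hpp + hss⟩

section boost

variable {p : ℂ} (hp : Complex.normSq p = 1) {s : ℝ} (hs : s ≠ 0)

theorem preservesForm_boost : PreservesForm (boost p hp s hs) :=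
  ⟨1, by norm_num, by simp [boost, Complex.conj_ofNat], by simp [boost, Complex.conj_ofNat]⟩

theorem boost_mulVec : (boost p hp s hs).1 *ᵥ ![p, 1] = (s : ℂ) • ![p, 1] := by
  have hpp : p * conj p = 1 := by rw [Complex.mul_conj, hp, Complex.ofReal_one]
  ext i
  fin_cases i <;> simp [boost, mulVec, dotProduct, Fin.sum_univ_two]
  · ring
  · linear_combination (((s : ℂ) - (s : ℂ)⁻¹) / 2) * hpp

theorem boost_mulVec_neg : (boost p hp s hs).1 *ᵥ ![-p, 1] = ((s⁻¹ : ℝ) : ℂ) • ![-p, 1] := by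
  have hpp : p * conj p = 1 := by rw [Complex.mul_conj, hp, Complex.ofReal_one]
  ext i
  fin_cases i <;> simp [boost, mulVec, dotProduct, Fin.sum_univ_two]
  · ring
  · linear_combination (-((s : ℂ) - (s : ℂ)⁻¹) / 2) * hpp

end boost

theorem matNormSq_eq_half_add {p : ℂ} (hp : Complex.normSq p = 1)
    (M : Matrix (Fin 2) (Fin 2) ℂ) :
    matNormSq M = (vecNormSq (M *ᵥ ![p, 1]) + vecNormSq (M *ᵥ ![-p, 1])) / 2 := by
  have e : ∀ a b : ℂ, Complex.normSq (a * p + b * 1) + Complex.normSq (a * -p + b * 1) =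
      2 * (Complex.normSq a * Complex.normSq p + Complex.normSq b) := by
    intro a b
    simp only [Complex.normSq_apply, Complex.add_re, Complex.add_im, Complex.mul_re,
      Complex.mul_im, Complex.neg_re, Complex.neg_im, Complex.one_re, Complex.one_im]
    ring
  have e0 := e (M 0 0) (M 0 1)
  have e1 := e (M 1 0) (M 1 1)
  simp only [hp, mul_one] at e0 e1
  simp only [vecNormSq, mulVec_zero_apply, mulVec_one_apply, cons_val_zero, cons_val_one, matNormSq,
    mul_one]
  linarith

/-- Moving along the geodesic with end points `±p` in the plane of the unit circle, one reaches a
point that `B` maps near the base point as soon as `B p` and `B (-p)` are not too close. -/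
theorem exists_preservesForm_matNormSq_le {p : ℂ} (hp : Complex.normSq p = 1) (B : SL(2, ℂ)) :
    ∃ h : SL(2, ℂ), PreservesForm h ∧ matNormSq (B * h).1 =
      (1 + vecNormSq (B.1 *ᵥ ![p, 1]) * vecNormSq (B.1 *ᵥ ![-p, 1])) / 2 := by
  have hpos : 0 < vecNormSq (B.1 *ᵥ ![p, 1]) := vecNormSq_pos (mulVec_ne_zero B (by simp))
  have hs : (√(vecNormSq (B.1 *ᵥ ![p, 1])))⁻¹ ≠ 0 := inv_ne_zero (Real.sqrt_pos.2 hpos).ne'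
  refine ⟨boost p hp _ hs, preservesForm_boost hp hs, ?_⟩
  rw [matNormSq_eq_half_add hp, Matrix.SpecialLinearGroup.coe_mul, ← mulVec_mulVec,
    ← mulVec_mulVec, boost_mulVec, boost_mulVec_neg, mulVec_smul, mulVec_smul, vecNormSq_smul,
    vecNormSq_smul, Complex.normSq_ofReal, Complex.normSq_ofReal, ← sq, ← sq, inv_inv, inv_pow,
    Real.sq_sqrt hpos.le, inv_mul_cancel₀ hpos.ne']

/-- A limit point all of whose boundary images lie on the unit circle is contracted, in all
coordinates at once, by elements of the stabilizer of the torus. -/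
theorem exists_contracting {d : ℕ} [NeZero d] {Γ : Subgroup PSL2C} {ρ : Fin d → Γ →* PSL2C}
    (hΓ : IsConvexCocompact Γ) (hinj : ∀ i, Function.Injective (ρ i))
    (hdisc : ∀ i, DiscreteTopology (ρ i).range)
    (h3 : ∃ x : Fin 3 → limitSet Γ, Function.Injective x)
    (hP : LocallyFiniteTori (torusOrbit ρ (torus₀ d)))
    {f : ∀ i, limitSet Γ ≃ₜ limitSet (ρ i).range} (hf : ∀ i, IsBoundaryMap (ρ i) (f i))
    (ξ : limitSet Γ) {p : Fin d → ℂ} (hp : ∀ i, Complex.normSq (p i) = 1)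
    (hξ : ∀ i, (f i ξ : Sphere) = toSphere ![p i, 1]) {ε : ℝ} (hε : 0 < ε) :
    ∃ (δ : Γ) (D : Fin d → SL(2, ℂ)), (∀ i, (D i : PSL2C) = ρ i δ) ∧
      (∀ i, ρ i δ • unitCircle = unitCircle) ∧ ∀ i, vecNormSq ((D i).1 *ᵥ ![p i, 1]) < ε := by
  obtain ⟨η, hη⟩ : ∃ η : limitSet Γ, (ξ : Sphere) ≠ η := by
    obtain ⟨x, hx⟩ := h3
    by_contra! hcon
    have h01 : x 0 = x 1 := Subtype.ext ((hcon _).symm.trans (hcon _))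
    exact absurd (hx h01) (by decide)
  obtain ⟨γ, A, u, w, hA, hatt, hcon⟩ := hΓ.exists_conical ξ.2 η.2 hη
  have hsize : Tendsto (fun n => sizeSq (Γ.subtype (γ n))) (hyperfilter ℕ : Filter ℕ) atTop := by
    refine hatt.tendsto_matNormSq.congr fun n => ?_
    rw [← sizeSq_coe]
    exact congrArg sizeSq (hA n)
  choose B hB using fun i n => QuotientGroup.mk_surjective (ρ i (γ n))
  have hv : ∀ i, wedge ![p i, 1] ![-p i, 1] ≠ 0 := by
    intro i
    have h0 : p i ≠ 0 := fun h => by have := hp i; simp [h] at this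
    have : wedge ![p i, 1] ![-p i, 1] = 2 * p i := by simp [wedge]; ring
    rw [this]
    exact mul_ne_zero two_ne_zero h0
  have key : ∀ i, (∃ C, ∀ᶠ n in (hyperfilter ℕ : Filter ℕ),
      vecNormSq ((B i n).1 *ᵥ ![p i, 1]) * vecNormSq ((B i n).1 *ᵥ ![-p i, 1]) ≤ C) ∧
      Tendsto (fun n => vecNormSq ((B i n).1 *ᵥ ![-p i, 1])) (hyperfilter ℕ : Filter ℕ) atTop := by
    intro i
    have hsB : Tendsto (fun n => matNormSq (B i n).1) (hyperfilter ℕ : Filter ℕ) atTop := by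
      refine (tendsto_sizeSq_of_injective _ _ (hinj i) (hdisc i) _ hsize).congr fun n => ?_
      rw [← sizeSq_coe]
      exact congrArg sizeSq (hB i n).symm
    obtain ⟨u', w', hatt'⟩ := exists_attracts _ hsB
    have hn := (hf i).not_tendsto h3 hA (hB i) hatt hatt' ξ hcon
    rw [hξ] at hn
    -- the limit point is the repelling point, and its antipode `-p i` on the circle is attracted
    have hw0 : w' ⬝ᵥ ![p i, 1] = 0 := by
      by_contra h0
      exact hn (hatt'.tendsto_smul h0)
    have hw1 := dotProduct_ne_zero_of_wedge_ne_zero hatt'.2.1 hw0 (hv i)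
    exact ⟨hatt'.exists_bound_mul hw1 (hv i) hn, hatt'.tendsto_vecNormSq hw1⟩
  choose C hC using fun i => (key i).1
  have hzero : ∀ i, Tendsto (fun n => vecNormSq ((B i n).1 *ᵥ ![p i, 1]))
      (hyperfilter ℕ : Filter ℕ) (𝓝 0) := by
    intro i
    have hdiv := (tendsto_const_nhds (x := C i)).div_atTop (key i).2
    refine tendsto_of_tendsto_of_tendsto_of_le_of_le' tendsto_const_nhds hdiv
      (Eventually.of_forall fun n => vecNormSq_nonneg _) ?_
    filter_upwards [hC i] with n hn
    rw [le_div_iff₀ (vecNormSq_pos (mulVec_ne_zero _ (by simp)))]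
    exact hn
  -- the sequence passes through finitely many tori, so along the ultrafilter the torus is constant
  have hfin := finite_tori_of_bounded ρ hP (∑ i, |(1 + C i) / 2|)
  have hmem : ∀ᶠ n in (hyperfilter ℕ : Filter ℕ), ∃ T ∈ {T : Fin d → Set Sphere |
      ∃ γ : Γ, T = (fun i => ρ i γ • unitCircle) ∧ ∀ i, ∃ h : PSL2C, h • unitCircle = unitCircle ∧
        sizeSq (ρ i γ * h) ≤ ∑ i, |(1 + C i) / 2|}, (fun i => ρ i (γ n) • unitCircle) = T := by
    filter_upwards [eventually_all.2 hC] with n hn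
    refine ⟨_, ⟨γ n, rfl, fun i => ?_⟩, rfl⟩
    obtain ⟨h, hh, hBh⟩ := exists_preservesForm_matNormSq_le (hp i) (B i n)
    refine ⟨h, hh.smul_unitCircle, ?_⟩
    rw [← hB, ← QuotientGroup.mk_mul]
    refine (sizeSq_coe _).le.trans (hBh.le.trans ?_)
    refine le_trans ?_ (Finset.single_le_sum (f := fun i => |(1 + C i) / 2|)
      (fun i _ => abs_nonneg _) (Finset.mem_univ i))
    exact le_trans (by linarith [hn i]) (le_abs_self _)
  obtain ⟨T, -, hT⟩ := (Ultrafilter.eventually_exists_mem_iff hfin).1 hmem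
  obtain ⟨n₀, hn₀⟩ := hT.exists
  have hsmall : ∀ i, ∀ᶠ n in (hyperfilter ℕ : Filter ℕ),
      matNormSq (B i n₀).1 * vecNormSq ((B i n).1 *ᵥ ![p i, 1]) < ε := by
    intro i
    have := (hzero i).const_mul (matNormSq (B i n₀).1)
    rw [mul_zero] at this
    exact this.eventually_lt_const hε
  obtain ⟨n, hn, hsn⟩ := (hT.and (eventually_all.2 hsmall)).exists
  refine ⟨(γ n₀)⁻¹ * γ n, fun i => (B i n₀)⁻¹ * B i n, fun i => ?_, fun i => ?_, fun i => ?_⟩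
  · rw [map_mul, map_inv, ← hB, ← hB]
    rfl
  · have e : ρ i (γ n) • unitCircle = ρ i (γ n₀) • unitCircle := by
      rw [← hn₀] at hn
      exact congrFun hn i
    rw [map_mul, map_inv, mul_smul, e, inv_smul_smul]
  · rw [Matrix.SpecialLinearGroup.coe_mul, ← mulVec_mulVec]
    refine (vecNormSq_mulVec_le _ _).trans_lt ?_
    rw [matNormSq_inv]
    exact hsn i

/-! ### Geodesic rays orthogonal to the plane of the unit circle -/

theorem mulVec_e1 (M : Matrix (Fin 2) (Fin 2) ℂ) : M *ᵥ ![1, 0] = ![M 0 0, M 1 0] := by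
  ext i
  fin_cases i <;> simp [mulVec, dotProduct, Fin.sum_univ_two]

theorem mulVec_e2 (M : Matrix (Fin 2) (Fin 2) ℂ) : M *ᵥ ![0, 1] = ![M 0 1, M 1 1] := by
  ext i
  fin_cases i <;> simp [mulVec, dotProduct, Fin.sum_univ_two]

theorem diag_mulVec_e1 (t : ℝ) : (diag t).1 *ᵥ ![1, 0] = (Real.exp (t / 2) : ℂ) • ![1, 0] := by
  rw [diag_val]
  ext i
  fin_cases i <;> simp [mulVec, dotProduct, Fin.sum_univ_two]

theorem diag_mulVec_e2 (t : ℝ) : (diag t).1 *ᵥ ![0, 1] = (Real.exp (-t / 2) : ℂ) • ![0, 1] := by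
  rw [diag_val]
  ext i
  fin_cases i <;> simp [mulVec, dotProduct, Fin.sum_univ_two]

theorem matNormSq_eq_columns (M : Matrix (Fin 2) (Fin 2) ℂ) :
    matNormSq M = vecNormSq (M *ᵥ ![1, 0]) + vecNormSq (M *ᵥ ![0, 1]) := by
  rw [mulVec_e1, mulVec_e2]
  simp only [matNormSq, vecNormSq, cons_val_zero, cons_val_one]
  ring

theorem PreservesForm.vecNormSq_columns {h : SL(2, ℂ)} (hh : PreservesForm h) :
    vecNormSq (h.1 *ᵥ ![0, 1]) = vecNormSq (h.1 *ᵥ ![1, 0]) := by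
  rw [mulVec_e1, mulVec_e2]
  exact hh.normSq_columns

theorem normSq_exp_half (t : ℝ) : Complex.normSq (Real.exp (t / 2) : ℂ) = Real.exp t := by
  rw [Complex.normSq_ofReal, ← Real.exp_add]
  ring_nf

/-- A family of geodesic rays `h a_t` orthogonal to the plane spanned by the unit circle, with end
points `A M` for bounded `M`. -/
structure RaySystem {ι : Type*} (h A M : ι → SL(2, ℂ)) (t : ι → ℝ) (R : ℝ) : Prop where
  form : ∀ n, PreservesForm (h n)
  nonneg : ∀ n, 0 ≤ t n
  eq : ∀ n, h n * diag (t n) = A n * M n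
  le : ∀ n, matNormSq (M n).1 ≤ R

namespace RaySystem

variable {ι : Type*} {h A M : ι → SL(2, ℂ)} {t : ι → ℝ} {R : ℝ}

theorem mulVec_e1 (H : RaySystem h A M t R) (n : ι) :
    (A n).1 *ᵥ ((M n).1 *ᵥ ![1, 0]) = (Real.exp (t n / 2) : ℂ) • ((h n).1 *ᵥ ![1, 0]) := by
  rw [mulVec_mulVec, ← Matrix.SpecialLinearGroup.coe_mul, ← H.eq,
    Matrix.SpecialLinearGroup.coe_mul, ← mulVec_mulVec, diag_mulVec_e1, mulVec_smul]

theorem mulVec_e2 (H : RaySystem h A M t R) (n : ι) :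
    (A n).1 *ᵥ ((M n).1 *ᵥ ![0, 1]) = (Real.exp (-t n / 2) : ℂ) • ((h n).1 *ᵥ ![0, 1]) := by
  rw [mulVec_mulVec, ← Matrix.SpecialLinearGroup.coe_mul, ← H.eq,
    Matrix.SpecialLinearGroup.coe_mul, ← mulVec_mulVec, diag_mulVec_e2, mulVec_smul]

theorem vecNormSq_e1 (H : RaySystem h A M t R) (n : ι) :
    vecNormSq ((A n).1 *ᵥ ((M n).1 *ᵥ ![1, 0])) =
      Real.exp (t n) * vecNormSq ((h n).1 *ᵥ ![1, 0]) := by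
  rw [H.mulVec_e1, vecNormSq_smul, normSq_exp_half]

theorem vecNormSq_e2 (H : RaySystem h A M t R) (n : ι) :
    vecNormSq ((A n).1 *ᵥ ((M n).1 *ᵥ ![0, 1])) =
      Real.exp (-t n) * vecNormSq ((h n).1 *ᵥ ![1, 0]) := by
  rw [H.mulVec_e2, vecNormSq_smul, normSq_exp_half, (H.form n).vecNormSq_columns]

theorem matNormSq_le (H : RaySystem h A M t R) (n : ι) :
    matNormSq (h n).1 ≤ matNormSq (A n).1 * R := by
  have h1 : matNormSq (h n).1 ≤ matNormSq (A n * M n).1 := by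
    rw [matNormSq_eq_columns, (H.form n).vecNormSq_columns, matNormSq_eq_columns,
      Matrix.SpecialLinearGroup.coe_mul, ← mulVec_mulVec, ← mulVec_mulVec, H.vecNormSq_e1,
      H.vecNormSq_e2]
    have hc := vecNormSq_nonneg ((h n).1 *ᵥ ![1, 0])
    have e1 : Real.exp (t n) * Real.exp (-t n) = 1 := by rw [← Real.exp_add]; simp
    have e2 := Real.exp_pos (t n)
    have e3 := Real.exp_pos (-t n)
    nlinarith [mul_nonneg (add_nonneg e2.le e3.le) hc, sq_nonneg (Real.exp (t n) - 1),
      sq_nonneg (Real.exp (t n) - Real.exp (-t n)), Real.add_one_le_exp (t n),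
      Real.add_one_le_exp (-t n)]
  refine h1.trans ((matNormSq_mul_le _ _).trans ?_)
  exact mul_le_mul_of_nonneg_left (H.le n) (matNormSq_nonneg _)

theorem tendsto_matNormSq (H : RaySystem h A M t R) {l : Filter ι} [l.NeBot]
    (hh : Tendsto (fun n => matNormSq (h n).1) l atTop) :
    Tendsto (fun n => matNormSq (A n).1) l atTop := by
  obtain ⟨n⟩ := (inferInstance : l.NeBot).nonempty
  have hR : 0 < R := (matNormSq_pos (M n)).trans_le (H.le n)
  refine tendsto_atTop_mono (fun n => ?_) (hh.atTop_div_const hR)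
  rw [div_le_iff₀ hR]
  exact H.matNormSq_le n

theorem tendsto_scaled_mulVec {l : Filter ι} {s : ι → ℝ} {u w : Fin 2 → ℂ} {M₀ : SL(2, ℂ)}
    (hs : Tendsto (fun n => (s n : ℂ) • (A n).1) l (𝓝 (vecMulVec u w)))
    (hM : Tendsto M l (𝓝 M₀)) (e : Fin 2 → ℂ) :
    Tendsto (fun n => (s n : ℂ) • ((A n).1 *ᵥ ((M n).1 *ᵥ e))) l
      (𝓝 ((w ⬝ᵥ (M₀.1 *ᵥ e)) • u)) := by
  have hc : Continuous fun B : SL(2, ℂ) => B.1 *ᵥ e :=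
    continuous_subtype_val.matrix_mulVec continuous_const
  rw [← vecMulVec_mulVec_eq]
  exact tendsto_smul_mulVec hs ((hc.tendsto M₀).comp hM)

theorem dotProduct_e1_ne_zero {w : Fin 2 → ℂ} (hw : w ≠ 0) {B : SL(2, ℂ)}
    (h2 : w ⬝ᵥ (B.1 *ᵥ ![0, 1]) = 0) : w ⬝ᵥ (B.1 *ᵥ ![1, 0]) ≠ 0 :=
  dotProduct_ne_zero_of_wedge_ne_zero hw h2 (by rw [wedge_mulVec]; simp [wedge])

/-- If the starting points of the rays diverge, then the rays converge to the limit of the starting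
points, which lies on the unit circle. -/
theorem toSphere_eq (H : RaySystem h A M t R) {l : Ultrafilter ι} {u w u' w' : Fin 2 → ℂ}
    (hh : Attracts l h u' w') (hA : Attracts l A u w) :
    toSphere u = toSphere u' ∧ toSphere u' ∈ unitCircle := by
  obtain ⟨M₀, hM⟩ := exists_tendsto_of_matNormSq_le l (Eventually.of_forall H.le)
  -- the columns of `h n` have equal norms, so neither vanishes in the limit
  have hw' : w' ⬝ᵥ ![1, 0] ≠ 0 := by
    obtain ⟨hu', hw', s, hs, hs0, hlim⟩ := hh
    have c1 := (continuous_vecNormSq.tendsto _).comp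
      (tendsto_smul_mulVec hlim (tendsto_const_nhds (x := ![1, 0])))
    have c2 := (continuous_vecNormSq.tendsto _).comp
      (tendsto_smul_mulVec hlim (tendsto_const_nhds (x := ![0, 1])))
    have e := tendsto_nhds_unique c1 (c2.congr fun n => by
      simp only [Function.comp, vecNormSq_smul, (H.form n).vecNormSq_columns])
    rw [vecMulVec_mulVec_eq, vecMulVec_mulVec_eq, vecNormSq_smul, vecNormSq_smul] at e
    have e' := mul_right_cancel₀ (vecNormSq_pos hu').ne' e
    intro h0
    rw [h0, map_zero, eq_comm, Complex.normSq_eq_zero] at e'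
    have a0 : w' 0 = 0 := by simpa [dotProduct, Fin.sum_univ_two] using h0
    have a1 : w' 1 = 0 := by simpa [dotProduct, Fin.sum_univ_two] using e'
    rcases (vec_ne_zero_iff w').1 hw' with h | h
    · exact h a0
    · exact h a1
  -- as `t ≥ 0`, the first column of `h a_t = A M` dominates the second
  have hw : w ⬝ᵥ (M₀.1 *ᵥ ![1, 0]) ≠ 0 := by
    obtain ⟨hu, hw, s, hs, hs0, hlim⟩ := hA
    intro h1
    have c1 := (continuous_vecNormSq.tendsto _).comp (tendsto_scaled_mulVec hlim hM ![1, 0])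
    have c2 := (continuous_vecNormSq.tendsto _).comp (tendsto_scaled_mulVec hlim hM ![0, 1])
    have hle := le_of_tendsto_of_tendsto' c2 c1 fun n => by
      simp only [Function.comp, vecNormSq_smul, H.vecNormSq_e1, H.vecNormSq_e2]
      refine mul_le_mul_of_nonneg_left ?_ (Complex.normSq_nonneg _)
      refine mul_le_mul_of_nonneg_right ?_ (vecNormSq_nonneg _)
      exact Real.exp_le_exp.2 (by linarith [H.nonneg n])
    rw [h1, vecNormSq_smul, vecNormSq_smul, map_zero, zero_mul] at hle
    have h2 : w ⬝ᵥ (M₀.1 *ᵥ ![0, 1]) = 0 := by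
      by_contra h2
      exact absurd (mul_pos (Complex.normSq_pos.2 h2) (vecNormSq_pos hu)) (not_lt.2 hle)
    exact dotProduct_e1_ne_zero hw h2 h1
  constructor
  · have hc : Continuous fun B : SL(2, ℂ) => B.1 *ᵥ (![1, 0] : Fin 2 → ℂ) :=
      continuous_subtype_val.matrix_mulVec continuous_const
    have t1 := hA.tendsto_toSphere ((hc.tendsto M₀).comp hM) hw
    have t2 := hh.tendsto_toSphere (tendsto_const_nhds (x := ![1, 0])) hw'
    refine tendsto_nhds_unique t1 (t2.congr fun n => ?_)
    simp only [Function.comp]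
    rw [H.mulVec_e1, toSphere_smul (Complex.ofReal_ne_zero.2 (Real.exp_pos _).ne')]
  · obtain ⟨hu', -, s, hs, hs0, hlim⟩ := hh
    rw [toSphere_mem_unitCircle hu']
    have hq : Continuous fun v : Fin 2 → ℂ =>
        (Complex.normSq (v 0) - Complex.normSq (v 1)) ^ 2 :=
      ((Complex.continuous_normSq.comp (continuous_apply 0)).sub
        (Complex.continuous_normSq.comp (continuous_apply 1))).pow 2
    have c1 := (hq.tendsto _).comp
      (tendsto_smul_mulVec hlim (tendsto_const_nhds (x := ![1, 0])))
    have c2 : Tendsto (fun n => s n ^ 4) l (𝓝 0) := by simpa using hs0.pow 4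
    have e := tendsto_nhds_unique c1 (c2.congr fun n => by
      have := (H.form n).normSq_sub ![1, 0]
      simp only [cons_val_zero, cons_val_one, map_one, map_zero, sub_zero, one_pow] at this
      simp only [Function.comp, Pi.smul_apply, smul_eq_mul, Complex.normSq_mul,
        Complex.normSq_ofReal]
      linear_combination (-s n ^ 4) * this)
    rw [vecMulVec_mulVec_eq] at e
    simp only [Pi.smul_apply, smul_eq_mul, Complex.normSq_mul] at e
    have e' := (pow_eq_zero_iff two_ne_zero).1 e
    rw [← mul_sub] at e'
    exact sub_eq_zero.1 ((mul_eq_zero.1 e').resolve_left (Complex.normSq_pos.2 hw').ne')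

/-- If the rays converge to a point of the unit circle, then their starting points diverge: a ray
from a bounded starting point ends away from the unit circle. -/
theorem tendsto_matNormSq_of_mem (H : RaySystem h A M t R) {l : Ultrafilter ι}
    {u w : Fin 2 → ℂ} (hA : Attracts l A u w) (hu : toSphere u ∈ unitCircle) :
    Tendsto (fun n => matNormSq (h n).1) l atTop := by
  by_contra hcon
  obtain ⟨C, hC⟩ := exists_bound_of_not_tendsto l hcon
  have hcol : ∀ᶠ n in (l : Filter ι), vecNormSq ((h n).1 *ᵥ ![1, 0]) ≤ C := by
    filter_upwards [hC] with n hn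
    rw [matNormSq_eq_columns] at hn
    linarith [vecNormSq_nonneg ((h n).1 *ᵥ ![0, 1])]
  obtain ⟨M₀, hM⟩ := exists_tendsto_of_matNormSq_le l (Eventually.of_forall H.le)
  obtain ⟨hu0, hw, s, hs, hs0, hlim⟩ := hA
  rw [toSphere_mem_unitCircle hu0] at hu
  have d1 := tendsto_scaled_mulVec hlim hM ![1, 0]
  have d2 := tendsto_scaled_mulVec hlim hM ![0, 1]
  have c1 := (continuous_vecNormSq.tendsto _).comp d1
  have c2 := (continuous_vecNormSq.tendsto _).comp d2
  -- the rescaled second column tends to zero, so the first one tends to a non-zero multiple of `u`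
  have h2 : w ⬝ᵥ (M₀.1 *ᵥ ![0, 1]) = 0 := by
    have hz : Tendsto (fun n => s n ^ 2 * C) l (𝓝 0) := by simpa using (hs0.pow 2).mul_const C
    have hle := le_of_tendsto_of_tendsto c2 hz (by
      filter_upwards [hcol] with n hn
      simp only [Function.comp, vecNormSq_smul, H.vecNormSq_e2, Complex.normSq_ofReal, ← sq]
      refine mul_le_mul_of_nonneg_left ?_ (sq_nonneg _)
      have h1 : Real.exp (-t n) ≤ 1 := Real.exp_le_one_iff.2 (by linarith [H.nonneg n])
      have h3 := vecNormSq_nonneg ((h n).1 *ᵥ ![1, 0])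
      nlinarith)
    rw [vecNormSq_smul] at hle
    by_contra h2
    exact absurd (mul_pos (Complex.normSq_pos.2 h2) (vecNormSq_pos hu0)) (not_lt.2 hle)
  have h1 := dotProduct_e1_ne_zero hw h2
  have hq : Continuous fun v : Fin 2 → ℂ =>
      (Complex.normSq (v 0) - Complex.normSq (v 1)) ^ 2 :=
    ((Complex.continuous_normSq.comp (continuous_apply 0)).sub
      (Complex.continuous_normSq.comp (continuous_apply 1))).pow 2
  have q1 := (hq.tendsto _).comp d1
  simp only [Pi.smul_apply, smul_eq_mul, Complex.normSq_mul, hu, sub_self,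
    zero_pow two_ne_zero] at q1
  -- the form takes the values `±1` on `h e₁` and vanishes at `u`, so the rescaling factor of the first
  -- column tends to zero
  have q2 : Tendsto (fun n => s n ^ 2 * Real.exp (t n)) l (𝓝 0) := by
    have q3 := (Real.continuous_sqrt.tendsto 0).comp q1
    rw [Real.sqrt_zero] at q3
    refine q3.congr fun n => ?_
    have hQ := (H.form n).normSq_sub ![1, 0]
    simp only [cons_val_zero, cons_val_one, map_one, map_zero, sub_zero, one_pow] at hQ
    simp only [Function.comp, Pi.smul_apply, smul_eq_mul, Complex.normSq_mul, H.mulVec_e1,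
      normSq_exp_half]
    rw [Complex.normSq_ofReal, ← Real.sqrt_sq (mul_nonneg (sq_nonneg (s n)) (Real.exp_pos (t n)).le)]
    congr 1
    linear_combination (s n ^ 4 * Real.exp (t n) ^ 2) * hQ
  have hz : Tendsto (fun n => s n ^ 2 * Real.exp (t n) * C) l (𝓝 0) := by
    simpa using q2.mul_const C
  have hle := le_of_tendsto_of_tendsto c1 hz (by
    filter_upwards [hcol] with n hn
    simp only [Function.comp, vecNormSq_smul, H.vecNormSq_e1, Complex.normSq_ofReal, ← sq]
    rw [← mul_assoc]
    exact mul_le_mul_of_nonneg_left hn (mul_nonneg (sq_nonneg _) (Real.exp_pos _).le))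
  rw [vecNormSq_smul] at hle
  exact absurd (mul_pos (Complex.normSq_pos.2 h1) (vecNormSq_pos hu0)) (not_lt.2 hle)

end RaySystem

/-! ### Compactness in the stabilizer of the torus -/

theorem mem_H_iff {d : ℕ} (g : G d) : g ∈ H d ↔ ∀ i, g i • unitCircle = unitCircle := by
  simp [H, torus₀, Subgroup.mem_pi, MulAction.mem_stabilizer_iff]

theorem isClosed_stabilizer_unitCircle : IsClosed {g : PSL2C | g • unitCircle = unitCircle} := by
  rw [← (QuotientGroup.isQuotientMap_mk _).isClosed_preimage]
  have e : (QuotientGroup.mk : SL(2, ℂ) → PSL2C) ⁻¹' {g : PSL2C | g • unitCircle = unitCircle} =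
      ⋃ p ∈ ({1, -1} : Set ℝ), {A : SL(2, ℂ) | A.1 1 1 = p * conj (A.1 0 0)} ∩
        {A : SL(2, ℂ) | A.1 0 1 = p * conj (A.1 1 0)} := by
    ext A
    have h : A ∈ (QuotientGroup.mk : SL(2, ℂ) → PSL2C) ⁻¹'
        {g : PSL2C | g • unitCircle = unitCircle} ↔ PreservesForm A :=
      ⟨preservesForm_of_smul_unitCircle, PreservesForm.smul_unitCircle⟩
    rw [h]
    simp only [PreservesForm, mem_iUnion, mem_insert_iff, mem_singleton_iff, exists_prop,
      mem_inter_iff]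
    constructor <;> rintro ⟨p, hp, h1, h2⟩ <;> refine ⟨p, ?_, h1, h2⟩
    · exact mul_self_eq_one_iff.1 (by rw [← sq, hp])
    · rw [sq]; exact mul_self_eq_one_iff.2 hp
  rw [e]
  have hc := continuous_sl_entry
  refine (Set.toFinite _).isClosed_biUnion fun p _ => IsClosed.inter ?_ ?_
  · exact isClosed_eq (hc 1 1) (continuous_const.mul (Complex.continuous_conj.comp (hc 0 0)))
  · exact isClosed_eq (hc 0 1) (continuous_const.mul (Complex.continuous_conj.comp (hc 1 0)))

theorem isClosed_H (d : ℕ) : IsClosed (H d : Set (G d)) := by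
  have e : (H d : Set (G d)) = ⋂ i, {g : G d | g i • unitCircle = unitCircle} := by
    ext g
    rw [SetLike.mem_coe, mem_H_iff, mem_iInter]
    rfl
  rw [e]
  exact isClosed_iInter fun i =>
    isClosed_stabilizer_unitCircle.preimage (f := fun g : G d => g i) (continuous_apply i)

/-- The total size `∑ᵢ 2 cosh d(o, gᵢ o)` of an element of `G`. -/
def totalSize {d : ℕ} (g : G d) : ℝ := ∑ i, sizeSq (g i)

theorem continuous_totalSize (d : ℕ) : Continuous (totalSize : G d → ℝ) :=
  continuous_finsetSum _ fun i _ => continuous_sizeSq.comp (continuous_apply i)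

theorem sizeSq_le_totalSize {d : ℕ} (g : G d) (i : Fin d) : sizeSq (g i) ≤ totalSize g :=
  Finset.single_le_sum (f := fun i => sizeSq (g i)) (fun _ _ => (sizeSq_pos _).le)
    (Finset.mem_univ i)

theorem totalSize_nonneg {d : ℕ} (g : G d) : 0 ≤ totalSize g :=
  Finset.sum_nonneg fun _ _ => (sizeSq_pos _).le

theorem isCompact_totalSize_le (d : ℕ) (R : ℝ) :
    IsCompact {h : H d | totalSize (h : G d) ≤ R} := by
  have hK : IsCompact {g : G d | totalSize g ≤ R} := by
    refine IsCompact.of_isClosed_subset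
      (isCompact_univ_pi fun _ : Fin d => isCompact_sizeSq_le R)
      (isClosed_le (continuous_totalSize d) continuous_const) ?_
    exact fun g hg i _ => (sizeSq_le_totalSize g i).trans hg
  exact (isClosed_H d).isClosedEmbedding_subtypeVal.isCompact_preimage hK

/-! ### Minimal representatives of returning rays -/

/-- A returning class has a representative `h` whose size is almost minimal in its orbit under
`Γ_ρ ∩ H`. -/
theorem exists_almost_minimal {d : ℕ} {Γ : Subgroup PSL2C} {ρ : Fin d → Γ →* PSL2C}
    {O : Set (LeftQuot (selfJoining ρ))} {R : ℝ}
    (hR : ∀ g : G d, leftClass (selfJoining ρ) g ∈ O →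
      ∃ γ : selfJoining ρ, totalSize ((γ : G d) * g) ≤ R)
    {x : LeftQuot ((selfJoining ρ).subgroupOf (H d))} (hx : x ∈ returnSet (selfJoining ρ) O) :
    ∃ h : H d, x = leftClass _ h ∧
      (∃ (γ : Γ) (t : Fin d → ℝ), (∀ i, 0 ≤ t i) ∧
        ∀ i, sizeSq (ρ i γ * ((h : G d) i * (diag (t i) : PSL2C))) ≤ R) ∧
      ∀ δ : Γ, (∀ i, ρ i δ • unitCircle = unitCircle) →
        totalSize (h : G d) ≤ totalSize (fun i => ρ i δ * (h : G d) i) + 1 := by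
  obtain ⟨h₀, hx₀, a, ⟨t, ht, rfl⟩, ha⟩ := hx
  let S : Set ℝ := {r | ∃ h : H d, x = leftClass _ h ∧ r = totalSize (h : G d)}
  have hS : S.Nonempty := ⟨_, h₀, hx₀, rfl⟩
  have hbdd : BddBelow S := ⟨0, by rintro _ ⟨h, -, rfl⟩; exact totalSize_nonneg _⟩
  obtain ⟨_, ⟨h, hxh, rfl⟩, hlt⟩ := Real.lt_sInf_add_pos hS one_pos
  refine ⟨h, hxh, ?_, ?_⟩
  · obtain ⟨δ, hδ⟩ := Quotient.exact (hxh.symm.trans hx₀)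
    have hδ' : ((δ : H d) : G d) * (h₀ : G d) = h := congrArg Subtype.val hδ
    have hδm : ((δ : H d) : G d) ∈ selfJoining ρ := δ.2
    have hO : leftClass (selfJoining ρ) ((h : G d) * fun i => (diag (t i) : PSL2C)) ∈ O := by
      have e : leftClass (selfJoining ρ) ((h : G d) * fun i => (diag (t i) : PSL2C)) =
          leftClass (selfJoining ρ) ((h₀ : G d) * fun i => (diag (t i) : PSL2C)) :=
        Quotient.sound ⟨⟨_, hδm⟩, by
          change ((δ : H d) : G d) * ((h₀ : G d) * _) = _
          rw [← mul_assoc, hδ']⟩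
      rw [e]
      exact ha
    obtain ⟨⟨_, γ, rfl⟩, hγ⟩ := hR _ hO
    refine ⟨γ, t, ht, fun i => le_trans ?_ hγ⟩
    exact sizeSq_le_totalSize
      ((fun i => ρ i γ) * ((h : G d) * fun i => (diag (t i) : PSL2C)) : G d) i
  · intro δ hδ
    let k : H d := ⟨fun i => ρ i δ, (mem_H_iff _).2 hδ⟩
    have hk : k ∈ (selfJoining ρ).subgroupOf (H d) := ⟨δ, rfl⟩
    have hmem : totalSize ((k * h : H d) : G d) ∈ S :=
      ⟨k * h, hxh.trans (Quotient.sound ⟨⟨k⁻¹, inv_mem hk⟩, by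
        change k⁻¹ * (k * h) = h
        rw [inv_mul_cancel_left]⟩), rfl⟩
    have h1 : sInf S ≤ totalSize (fun i => ρ i δ * (h : G d) i) := csInf_le hbdd hmem
    linarith

/-- Membership of the images of a limit point in the circles of the torus does not depend on the
coordinate. -/
theorem exists_boundaryMaps {d : ℕ} [NeZero d] {Γ : Subgroup PSL2C} {ρ : Fin d → Γ →* PSL2C}
    (hP : IsAdmissiblePacking ρ (torusOrbit ρ (torus₀ d))) :
    ∃ f : ∀ i, limitSet Γ ≃ₜ limitSet (ρ i).range, (∀ i, IsBoundaryMap (ρ i) (f i)) ∧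
      ∀ i j ξ, (f i ξ : Sphere) ∈ unitCircle → (f j ξ : Sphere) ∈ unitCircle := by
  obtain ⟨⟨S, -, hS, hU⟩, -⟩ := hP
  have h0 : torus₀ d ∈ torusOrbit ρ (torus₀ d) := ⟨1, one_mem _, by simp⟩
  rw [hU] at h0
  obtain ⟨T, hT, hT0⟩ := mem_iUnion₂.1 h0
  obtain ⟨_, ⟨g, rfl⟩, hg⟩ := hT0
  have hg' : ∀ i, unitCircle = ρ i g • T i := fun i => congrFun hg i
  choose f hf hfT using fun i => ((hS T hT).2 i).2
  refine ⟨f, hf, fun i j ξ hξ => ?_⟩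
  have hgm : ((g⁻¹ : Γ) : PSL2C) • (ξ : Sphere) ∈ limitSet Γ := smul_mem_limitSet (g⁻¹).2 ξ.2
  let η : limitSet Γ := ⟨_, hgm⟩
  have hη : ∀ k, (f k ξ : Sphere) = ρ k g • (f k η : Sphere) := by
    intro k
    refine hf k g η ξ ?_
    change (ξ : Sphere) = (g : PSL2C) • ((g⁻¹ : Γ) : PSL2C) • (ξ : Sphere)
    rw [InvMemClass.coe_inv, smul_inv_smul]
  rw [hη, hg' i, Set.smul_mem_smul_set_iff] at hξ
  have h1 : (f i η : Sphere) ∈ (fun ξ => (f i ξ : Sphere)) '' {ξ | (ξ : Sphere) ∈ T 0} := by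
    rw [hfT]
    exact ⟨hξ, (f i η).2⟩
  obtain ⟨η', hη', he⟩ := h1
  have hηη : η' = η := (f i).injective (Subtype.ext he)
  rw [hηη] at hη'
  have h2 : (f j η : Sphere) ∈ T j ∩ limitSet (ρ j).range := by
    rw [← hfT]
    exact ⟨η, hη', rfl⟩
  rw [hη, hg' j, Set.smul_mem_smul_set_iff]
  exact h2.1

/-- A sequence of almost minimal starting points of returning rays cannot diverge. -/
theorem not_tendsto_totalSize {d : ℕ} [NeZero d] {Γ : Subgroup PSL2C} {ρ : Fin d → Γ →* PSL2C}
    (hΓ : IsConvexCocompact Γ) (hρ_id : ρ 0 = Γ.subtype)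
    (hinj : ∀ i, Function.Injective (ρ i)) (hdisc : ∀ i, DiscreteTopology (ρ i).range)
    (hZ : IsZariskiDense (selfJoining ρ : Set (G d)))
    (hP : IsAdmissiblePacking ρ (torusOrbit ρ (torus₀ d))) {R : ℝ}
    {h : ℕ → G d} (hH : ∀ n i, h n i • unitCircle = unitCircle) {γ : ℕ → Γ} {t : ℕ → Fin d → ℝ}
    (ht : ∀ n i, 0 ≤ t n i)
    (hR : ∀ n i, sizeSq (ρ i (γ n) * (h n i * (diag (t n i) : PSL2C))) ≤ R)
    (hmin : ∀ n, ∀ δ : Γ, (∀ i, ρ i δ • unitCircle = unitCircle) →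
      totalSize (h n) ≤ totalSize (fun i => ρ i δ * h n i) + 1) :
    ¬ Tendsto (fun n => totalSize (h n)) atTop atTop := by
  intro htend
  have hle : (hyperfilter ℕ : Filter ℕ) ≤ atTop := by
    rw [← Nat.cofinite_eq_atTop]; exact hyperfilter_le_cofinite
  replace htend := htend.mono_left hle
  obtain ⟨f, hf, hcirc⟩ := exists_boundaryMaps hP
  choose B hB using fun i n => QuotientGroup.mk_surjective (h n i)
  choose A hA using fun i n => QuotientGroup.mk_surjective (ρ i (γ n)⁻¹)
  have hsys : ∀ i, RaySystem (B i) (A i) (fun n => (A i n)⁻¹ * (B i n * diag (t n i)))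
      (fun n => t n i) R := by
    intro i
    refine ⟨fun n => preservesForm_of_smul_unitCircle ?_, fun n => ht n i, fun n => ?_,
      fun n => ?_⟩
    · refine Eq.trans ?_ (hH n i)
      exact congrArg (· • unitCircle) (hB i n)
    · rw [mul_inv_cancel_left]
    · rw [← sizeSq_coe]
      refine le_trans (le_of_eq (congrArg sizeSq ?_)) (hR n i)
      rw [QuotientGroup.mk_mul, QuotientGroup.mk_inv, QuotientGroup.mk_mul]
      have e1 : ((A i n : SL(2, ℂ)) : PSL2C) = ρ i (γ n)⁻¹ := hA i n
      have e2 : ((B i n : SL(2, ℂ)) : PSL2C) = h n i := hB i n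
      rw [e1, e2, map_inv, inv_inv]
  have hsizeB : ∀ i n, sizeSq (h n i) = matNormSq (B i n).1 := fun i n => by
    rw [← sizeSq_coe]; exact congrArg sizeSq (hB i n).symm
  have hsizeA : ∀ i n, sizeSq (ρ i (γ n)⁻¹) = matNormSq (A i n).1 := fun i n => by
    rw [← sizeSq_coe]; exact congrArg sizeSq (hA i n).symm
  -- some coordinate of the starting points diverges
  obtain ⟨k, hk⟩ : ∃ k, Tendsto (fun n => matNormSq (B k n).1) (hyperfilter ℕ : Filter ℕ) atTop := by
    by_contra! hcon
    choose C hC using fun i => exists_bound_of_not_tendsto _ (hcon i)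
    obtain ⟨n, hn, hn'⟩ :=
      ((eventually_all.2 hC).and (htend.eventually_gt_atTop (∑ i, C i))).exists
    refine absurd hn' (not_lt.2 (Finset.sum_le_sum fun i _ => ?_))
    rw [hsizeB]
    exact hn i
  -- hence the elements of `Γ` diverge, in every coordinate
  have hAk := (hsys k).tendsto_matNormSq hk
  have hAdiv : ∀ i, Tendsto (fun n => matNormSq (A i n).1) (hyperfilter ℕ : Filter ℕ) atTop := by
    intro i
    refine (tendsto_sizeSq_of_injective (ρ k) (ρ i) (hinj i) (hdisc i) (hyperfilter ℕ)
      (γ := fun n => (γ n)⁻¹) (hAk.congr fun n => (hsizeA k n).symm)).congr fun n => hsizeA i n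
  choose u w huw using fun i => exists_attracts _ (hAdiv i)
  have hA0 : ∀ n, ((A 0 n : SL(2, ℂ)) : PSL2C) = (γ n)⁻¹ := by
    intro n
    refine (hA 0 n).trans ?_
    rw [hρ_id]
    rfl
  have hξ : toSphere (u 0) ∈ limitSet Γ := (huw 0).mem_limitSet fun n => by
    rw [hA0]; exact inv_mem (γ n).2
  have h3 := exists_three_limit_points hρ_id hZ ⟨_, hξ⟩
  let ξ : limitSet Γ := ⟨_, hξ⟩
  have hfξ : ∀ i, (f i ξ : Sphere) = toSphere (u i) := fun i =>
    (hf i).apply_attracting h3 (γ := fun n => (γ n)⁻¹) hA0 (hA i) (huw 0) (huw i) ξ rfl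
  -- the common limit lies on the unit circle in the diverging coordinate, hence in all of them
  obtain ⟨u', w', hu'⟩ := exists_attracts _ hk
  have hmem : ∀ i, toSphere (u i) ∈ unitCircle := by
    intro i
    rw [← hfξ i]
    refine hcirc k i ξ ?_
    have := (hsys k).toSphere_eq hu' (huw k)
    rw [hfξ, this.1]
    exact this.2
  have hBdiv := fun i => (hsys i).tendsto_matNormSq_of_mem (huw i) (hmem i)
  choose v z hvz using fun i => exists_attracts _ (hBdiv i)
  have hv : ∀ i, toSphere (v i) = toSphere (u i) := fun i =>
    ((hsys i).toSphere_eq (hvz i) (huw i)).1.symm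
  choose p hp hpu using hmem
  have hp1 : ∀ i, Complex.normSq (p i) = 1 := fun i => by
    rw [Complex.normSq_eq_norm_sq, mem_sphere_zero_iff_norm.1 (hp i), one_pow]
  have hpu' : ∀ i, toSphere (u i) = toSphere ![p i, 1] := fun i => by
    rw [← hpu i]; simp [toSphere]
  obtain ⟨δ, D, hD, hδ, hsmall⟩ := exists_contracting hΓ hinj hdisc h3 hP.2 hf ξ hp1
    (fun i => (hfξ i).trans (hpu' i)) one_pos
  -- translating by `δ` halves the size of the starting points, contrary to minimality
  have hhalf : ∀ i, ∀ᶠ n in (hyperfilter ℕ : Filter ℕ),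
      matNormSq (D i * B i n).1 < matNormSq (B i n).1 / 2 := by
    intro i
    have hcontr : vecNormSq ((D i).1 *ᵥ v i) < vecNormSq (v i) / 2 := by
      have hw := (toSphere_eq_iff (hvz i).1 (by simp)).1 ((hv i).trans (hpu' i))
      have e : v i = (v i) 1 • ![p i, 1] := by
        simp only [wedge, cons_val_zero, cons_val_one] at hw
        ext j
        fin_cases j
        · simpa [sub_eq_zero] using hw
        · simp
      have h1 : vecNormSq ![p i, 1] = 2 := by
        simp only [vecNormSq, cons_val_zero, cons_val_one, hp1, map_one]; norm_num
      have hc : 0 < Complex.normSq ((v i) 1) := by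
        have := vecNormSq_pos (hvz i).1
        rw [e, vecNormSq_smul, h1] at this
        linarith
      rw [e, mulVec_smul, vecNormSq_smul, vecNormSq_smul, h1]
      nlinarith [hsmall i]
    obtain ⟨-, hz, s, hs, -, hlim⟩ := hvz i
    have hcont : Continuous fun M : Matrix (Fin 2) (Fin 2) ℂ => matNormSq ((D i).1 * M) :=
      continuous_matNormSq.comp (continuous_const.matrix_mul continuous_id)
    have l1 := (hcont.tendsto _).comp hlim
    have l2 := ((continuous_matNormSq.tendsto _).comp hlim).div_const 2
    rw [mul_vecMulVec, matNormSq_vecMulVec] at l1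
    rw [matNormSq_vecMulVec] at l2
    have hlt : vecNormSq ((D i).1 *ᵥ v i) * vecNormSq (z i) <
        vecNormSq (v i) * vecNormSq (z i) / 2 := by
      have := mul_lt_mul_of_pos_right hcontr (vecNormSq_pos hz)
      linarith
    filter_upwards [l1.eventually_lt l2 hlt] with n hn
    simp only [Function.comp, Matrix.mul_smul, matNormSq_smul, Complex.normSq_ofReal] at hn
    rw [mul_div_assoc] at hn
    exact lt_of_mul_lt_mul_left hn (mul_self_nonneg _)
  obtain ⟨n, hn, hn'⟩ := ((eventually_all.2 hhalf).and (htend.eventually_gt_atTop 2)).exists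
  have h1 : totalSize (fun i => ρ i δ * h n i) ≤ totalSize (h n) / 2 := by
    unfold totalSize
    rw [Finset.sum_div]
    refine Finset.sum_le_sum fun i _ => ?_
    rw [hsizeB]
    refine le_trans (le_of_eq ?_) (hn i).le
    rw [← sizeSq_coe, QuotientGroup.mk_mul]
    exact congrArg sizeSq (congrArg₂ (· * ·) (hD i) (hB i n)).symm
  have h2 := hmin n δ hδ
  linarith

end TorusPacking

end

theorem mainTheorem7 (d : ℕ) [NeZero d] (Γ : Subgroup TorusPacking.PSL2C)
    (ρ : Fin d → Γ →* TorusPacking.PSL2C)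
    (hΓ : TorusPacking.IsConvexCocompact Γ)
    (hρ_id : ρ 0 = Γ.subtype)
    (hρ_faithful : ∀ i, Function.Injective (ρ i))
    (hρ_cc : ∀ i, TorusPacking.IsConvexCocompact (ρ i).range)
    (hZ : TorusPacking.IsZariskiDense (TorusPacking.selfJoining ρ : Set (TorusPacking.G d)))
    (hP : TorusPacking.IsAdmissiblePacking ρ
      (TorusPacking.torusOrbit ρ (TorusPacking.torus₀ d)))
    (O : Set (TorusPacking.LeftQuot (TorusPacking.selfJoining ρ)))
    (hO : TorusPacking.IsBoundedSubset O) :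
    TorusPacking.IsBoundedSubset
      (TorusPacking.returnSet (TorusPacking.selfJoining ρ) O) := by
  obtain ⟨K, hK, hOK⟩ := hO
  obtain ⟨R, hR⟩ := TorusPacking.exists_bound_of_isCompact_quotient hK
    (TorusPacking.continuous_totalSize d)
  have hR' : ∀ g : TorusPacking.G d, TorusPacking.leftClass (TorusPacking.selfJoining ρ) g ∈ O →
      ∃ γ : TorusPacking.selfJoining ρ,
        TorusPacking.totalSize ((γ : TorusPacking.G d) * g) ≤ R := fun g hg => hR g (hOK hg)
  obtain ⟨C, hC⟩ : ∃ C : ℝ, ∀ x ∈ TorusPacking.returnSet (TorusPacking.selfJoining ρ) O,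
      ∃ h : TorusPacking.H d, x = TorusPacking.leftClass _ h ∧
        TorusPacking.totalSize (h : TorusPacking.G d) ≤ C := by
    by_contra! hcon
    choose x hx hlarge using fun n : ℕ => hcon n
    choose h hxh hret hmin using fun n => TorusPacking.exists_almost_minimal hR' (hx n)
    choose γ t ht hbd using hret
    refine TorusPacking.not_tendsto_totalSize hΓ hρ_id hρ_faithful (fun i => (hρ_cc i).1) hZ hP
      (fun n => (TorusPacking.mem_H_iff _).1 (h n).2) ht hbd hmin ?_
    exact tendsto_atTop_mono (fun n => (hlarge n _ (hxh n)).le) tendsto_natCast_atTop_atTop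
  refine ⟨_, (TorusPacking.isCompact_totalSize_le d C).image continuous_quotient_mk', ?_⟩
  intro x hx
  obtain ⟨h, hxh, hh⟩ := hC x hx
  exact ⟨h, hh, hxh.symm⟩
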